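/- Let $d\ge 1$ and let $p:\mathbb N_0\to[0,1]$ satisfy $p(0)=0$ and $c:=p(1)>0$; put $s:=p(2)/p(1)$. Let $X$ be a homogeneous Poisson point process on $\mathbb R^d$ with intensity $\lambda>0$, and let $r>0$. Attach to the points $x\in X$ i.i.d. $\mathrm{Uniform}(0,1)$ marks $U_x$, independent of $X$, and let the thinned process be \[ T_r(X)=\{x\in X:\ U_x\le p(n_r(x;X))\},\qquad n_r(x;X)=\#\big((X\cap B(x,r))\setminus\{x\}\big), \] where $B(x,r)$ is the closed Euclidean ball. Put $v_d:=|B(0,1)|$, $\mu:=\lambda v_d r^d$ and $\omega_d(t):=|B(0,1)\cap B(te_1,1)|/v_d$. Let $\rho_{T_r}$ be the intensity of $T_r(X)$ and $\rho^{(2)}$ its second-order product density, i.e. the density of $A\times B\mapsto\mathbb E\,\#\{(u,v):u\in T_r(X)\cap A,\ v\in T_r(X)\cap B,\ u\ne v\}$. Let $g^\circ_{T_r}$ be the radial pair-correlation function, $g^\circ_{T_r}(\|x-y\|)=\rho^{(2)}(x,y)/\rho_{T_r}^2$ for $x\ne y$. As densities are only determined almost everywhere, $g^\circ_{T_r}$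 is taken in the version that is continuous on $(0,r]$ and on $(r,\infty)$; part of the claim is that all these objects exist. Then, as $\mu\downarrow0$, \[ \rho_{T_r}=\lambda\,\mathbb E[p(N)]=\lambda\Big(\mu c+\mu^2\big(\tfrac12p(2)-c\big)+O(\mu^3)\Big),\qquad N\sim\mathrm{Poisson}(\mu), \] and moreover: (a) for $1<t\le2$, $\displaystyle g^\circ_{T_r}(tr)=\frac{\omega_d(t)}{\mu}+O(1)$; (b) for $0<t\le1$, $\displaystyle g^\circ_{T_r}(tr)=\frac1{\mu^2}\Big\{1+\mu\big[s+\omega_d(t)(1-s)^2\big]\Big\}+O(1)$. The $O$-terms are uniform in $t$, $\lambda$ and $r$: there are $\mu_0>0$ and $C<\infty$ depending only on $d$ and $p$ such that, whenever $\mu\le\mu_0$, the error terms are bounded by $C\mu^3$, $C$ and $C$, respectively. -/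

import Mathlib

open MeasureTheory ProbabilityTheory Set

noncomputable section

/-- Euclidean space of dimension `d`. -/
abbrev RSpace (d : ℕ) : Type := EuclideanSpace ℝ (Fin d)

/-- A (simple) point process: a random locally finite set of points such that all counts
`#(X ∩ B)`, `B` Borel, are random variables. -/
structure IsPointProcess {d : ℕ} {Ω : Type*} [MeasurableSpace Ω] (X : Ω → Set (RSpace d)) :
    Prop where
  locallyFinite : ∀ ω, ∀ B : Set (RSpace d), Bornology.IsBounded B → (X ω ∩ B).Finite
  measurable_count : ∀ B : Set (RSpace d), MeasurableSet B →
    Measurable fun ω => (X ω ∩ B).encard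

/-- `X` is a homogeneous Poisson point process of intensity `lam` with respect to Lebesgue
measure: counts in disjoint bounded Borel sets are independent, and the count in `A` has the
Poisson distribution with mean `lam * |A|`. -/
structure IsPoissonProcess {d : ℕ} {Ω : Type*} [MeasurableSpace Ω] (P : Measure Ω) (lam : ℝ)
    (X : Ω → Set (RSpace d)) : Prop where
  isPointProcess : IsPointProcess X
  law_count : ∀ A : Set (RSpace d), MeasurableSet A → Bornology.IsBounded A →
    P.map (fun ω => (X ω ∩ A).ncard) = poissonMeasure (lam * volume.real A).toNNReal
  indep_count : ∀ (k : ℕ) (A : Fin k → Set (RSpace d)),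
    (∀ i, MeasurableSet (A i)) → (∀ i, Bornology.IsBounded (A i)) →
    (∀ i j, i ≠ j → Disjoint (A i) (A j)) →
    iIndepFun (fun i ω => (X ω ∩ A i).ncard) P

/-- Independent `Uniform(0,1)` marks attached to the points of `X`. The points of `X` are
listed without repetition as `ξ i`, `i < κ`, where the number `κ` of points may be infinite;
the mark of the point `ξ i` is `U i`. The marks are i.i.d. uniform and independent of the
enumerated process. -/
structure IsIndependentMarking {d : ℕ} {Ω : Type*} [MeasurableSpace Ω] (P : Measure Ω)
    (X : Ω → Set (RSpace d)) (κ : Ω → ℕ∞) (ξ : ℕ → Ω → RSpace d) (U : ℕ → Ω → ℝ) : Prop where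
  measurable_card : Measurable κ
  measurable_point : ∀ i, Measurable (ξ i)
  measurable_mark : ∀ i, Measurable (U i)
  enumerates : ∀ᵐ ω ∂P, X ω = {x | ∃ i : ℕ, (i : ℕ∞) < κ ω ∧ ξ i ω = x}
  distinct : ∀ᵐ ω ∂P, ∀ i j : ℕ, (i : ℕ∞) < κ ω → (j : ℕ∞) < κ ω → ξ i ω = ξ j ω → i = j
  uniform : ∀ i, P.map (U i) = volume.restrict (Ioo (0 : ℝ) 1)
  indep_marks : iIndepFun U P
  indep_points : IndepFun (fun ω => (κ ω, fun i => ξ i ω)) (fun ω i => U i ω) P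

/-- `n_r(x; X)`: the number of points of `X` other than `x` in the closed ball `B(x, r)`. -/
def neighbourCount {d : ℕ} (r : ℝ) (x : RSpace d) (X : Set (RSpace d)) : ℕ :=
  ((X ∩ Metric.closedBall x r) \ {x}).ncard

/-- The neighbour-count dependent thinning `T_r(X)`: the point `x = ξ i` of `X` is retained
iff its mark satisfies `U i ≤ p (n_r(x; X))`. -/
def thinning {d : ℕ} {Ω : Type*} (p : ℕ → ℝ) (r : ℝ) (X : Ω → Set (RSpace d)) (κ : Ω → ℕ∞)
    (ξ : ℕ → Ω → RSpace d) (U : ℕ → Ω → ℝ) (ω : Ω) : Set (RSpace d) :=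
  {x | ∃ i : ℕ, (i : ℕ∞) < κ ω ∧ ξ i ω = x ∧ U i ω ≤ p (neighbourCount r x (X ω))}

/-- `ρ` is a density of the intensity measure `B ↦ E[#(Y ∩ B)]`. -/
structure HasIntensityDensity {d : ℕ} {Ω : Type*} [MeasurableSpace Ω] (P : Measure Ω)
    (Y : Ω → Set (RSpace d)) (ρ : RSpace d → ℝ) : Prop where
  measurable : Measurable ρ
  nonneg : ∀ x, 0 ≤ ρ x
  expected_count : ∀ B : Set (RSpace d), MeasurableSet B → Bornology.IsBounded B →
    ∫⁻ ω, ((Y ω ∩ B).encard : ENNReal) ∂P = ∫⁻ x in B, ENNReal.ofReal (ρ x)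

/-- `ρ₂` is a second-order product density of `Y`: a density of the second factorial moment
measure `A × B ↦ E[#{(u, v) : u ∈ Y ∩ A, v ∈ Y ∩ B, u ≠ v}]`. -/
structure HasPairDensity {d : ℕ} {Ω : Type*} [MeasurableSpace Ω] (P : Measure Ω)
    (Y : Ω → Set (RSpace d)) (ρ₂ : RSpace d → RSpace d → ℝ) : Prop where
  measurable : Measurable (Function.uncurry ρ₂)
  nonneg : ∀ x y, 0 ≤ ρ₂ x y
  expected_count : ∀ A B : Set (RSpace d), MeasurableSet A → Bornology.IsBounded A →
    MeasurableSet B → Bornology.IsBounded B →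
    ∫⁻ ω, ({q : RSpace d × RSpace d |
        q.1 ∈ Y ω ∩ A ∧ q.2 ∈ Y ω ∩ B ∧ q.1 ≠ q.2}.encard : ENNReal) ∂P
      = ∫⁻ x in A, ∫⁻ y in B, ENNReal.ofReal (ρ₂ x y)

/-- `g` is a radial pair-correlation function of `Y`: for `x ≠ y`, the value `g ‖x - y‖` is
the second-order product density at `(x, y)` divided by the product of the (positive)
intensity densities at `x` and at `y`. -/
def IsRadialPairCorrelation {d : ℕ} {Ω : Type*} [MeasurableSpace Ω] (P : Measure Ω)
    (Y : Ω → Set (RSpace d)) (g : ℝ → ℝ) : Prop :=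
  ∃ (ρ : RSpace d → ℝ) (ρ₂ : RSpace d → RSpace d → ℝ),
    HasIntensityDensity P Y ρ ∧ (∀ x, 0 < ρ x) ∧ HasPairDensity P Y ρ₂ ∧
    ∀ x y, x ≠ y → g ‖x - y‖ = ρ₂ x y / (ρ x * ρ y)

/-- `v_d`, the volume of the unit ball. -/
def unitBallVolume (d : ℕ) : ℝ := volume.real (Metric.closedBall (0 : RSpace d) 1)

/-- The normalized overlap coefficient `ω_d(t) = |B(0,1) ∩ B(t e₁,1)| / v_d`. -/
def overlapCoeff (d : ℕ) [NeZero d] (t : ℝ) : ℝ :=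
  volume.real (Metric.closedBall (0 : RSpace d) 1 ∩
    Metric.closedBall (EuclideanSpace.single (0 : Fin d) t) 1) / unitBallVolume d

end

/-! By the Mecke formula, the first and second moment densities of the thinned process are averages
over the Poisson process with one or two points added. Once the marks are integrated out, an added
point x contributes λ E p(N), with N the Poisson count in B(x,r). An added pair contributes λ²
E[p(e+I+J) p(e+I+K)], where I, J, K are the independent counts in the lens and the two crescents
formed by the balls, with means μw, μ(1-w), μ(1-w) for w = ω_d(‖x-y‖/r), and e is 1 if the two
points are neighbours and 0 otherwise. Given I, the two factors are independent and identically
distributed, which yields `pairRetention`.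

This form explains both regimes. If e = 1, each point already has a neighbour and the retention
probability tends to p(1)². If e = 0, then p(0) = 0 makes each point need a further neighbour; the
cheapest way is a single point in the lens, giving μ w p(1)². Division by (E p(N))², which is about
μ² p(1)², produces the orders μ⁻² and μ⁻¹. The explicit remainders come from
`abs_poissonMean_sub_sum_le` and `abs_pairRetention_sub_le`, and do not involve λ, r or t
separately.

The Mecke formula is derived from the laws of counts alone. For finitely many cells the counts are
independent Poisson variables and the formula reduces to (n+1) P(n+1) = a P(n) in each cell
(`IsPoissonProcess.lintegral_sum_cells`). For a fixed finite configuration, fine enough cells decide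
every relation dist ≤ r correctly, so dominated convergence gives the formula for ball counts
(`IsPoissonProcess.lintegral_sum_of_eventually_eq`); a second application gives the two-point
version. -/

/-! ### Poisson means for small parameter -/

/-- The expectation of `f N` for a Poisson variable `N` of mean `a`. -/
noncomputable def poissonMean (f : ℕ → ℝ) (a : ℝ) : ℝ := ∫ n, f n ∂poissonMeasure a.toNNReal

/-- The Poisson weights. -/
noncomputable def poissonWeight (a : ℝ) (n : ℕ) : ℝ := Real.exp (-a) * a ^ n / n.factorial

lemma poissonWeight_nonneg {a : ℝ} (ha : 0 ≤ a) (n : ℕ) : 0 ≤ poissonWeight a n := by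
  unfold poissonWeight; positivity

lemma hasSum_poissonWeight {a : ℝ} (ha : 0 ≤ a) : HasSum (poissonWeight a) 1 := by
  have := hasSum_one_poissonMeasure a.toNNReal
  rw [Real.coe_toNNReal a ha] at this
  exact this

lemma poissonMean_eq_tsum {a : ℝ} (ha : 0 ≤ a) (f : ℕ → ℝ) :
    poissonMean f a = ∑' n, poissonWeight a n * f n := by
  simp only [poissonMean, integral_poissonMeasure, Real.coe_toNNReal a ha, smul_eq_mul,
    poissonWeight]

lemma summable_poissonWeight_mul {a : ℝ} (ha : 0 ≤ a) {f : ℕ → ℝ} (hf : ∀ n, f n ∈ Icc (0 : ℝ) 1) :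
    Summable fun n => poissonWeight a n * f n :=
  Summable.of_nonneg_of_le (fun n => mul_nonneg (poissonWeight_nonneg ha n) (hf n).1)
    (fun n => mul_le_of_le_one_right (poissonWeight_nonneg ha n) (hf n).2)
    (hasSum_poissonWeight ha).summable

lemma poissonMean_mem_Icc {a : ℝ} (ha : 0 ≤ a) {f : ℕ → ℝ} (hf : ∀ n, f n ∈ Icc (0 : ℝ) 1) :
    poissonMean f a ∈ Icc (0 : ℝ) 1 := by
  rw [poissonMean_eq_tsum ha]
  refine ⟨tsum_nonneg fun n => mul_nonneg (poissonWeight_nonneg ha n) (hf n).1, ?_⟩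
  rw [← (hasSum_poissonWeight ha).tsum_eq]
  exact (summable_poissonWeight_mul ha hf).tsum_le_tsum
    (fun n => mul_le_of_le_one_right (poissonWeight_nonneg ha n) (hf n).2)
    (hasSum_poissonWeight ha).summable

lemma poissonWeight_add_le {a : ℝ} (ha : 0 ≤ a) (n k : ℕ) :
    poissonWeight a (n + k) ≤ a ^ k * poissonWeight a n := by
  have h : poissonWeight a (n + k) = Real.exp (-a) * a ^ n * a ^ k / (n + k).factorial := by
    rw [poissonWeight, pow_add]; ring
  have h' : a ^ k * poissonWeight a n = Real.exp (-a) * a ^ n * a ^ k / n.factorial := by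
    rw [poissonWeight]; ring
  rw [h, h']
  gcongr
  exact Nat.le_add_right n k

/-- Beyond index k a factor a^k comes out of the weights, since (n+k)! ≥ n!, and what is left has
total mass 1. Values in [0,1] make the bound independent of f. -/
lemma abs_poissonMean_sub_sum_le {a : ℝ} (ha : 0 ≤ a) {f : ℕ → ℝ}
    (hf : ∀ n, f n ∈ Icc (0 : ℝ) 1) (k : ℕ) :
    |poissonMean f a - ∑ n ∈ Finset.range k, poissonWeight a n * f n| ≤ a ^ k := by
  have hs := summable_poissonWeight_mul ha hf
  rw [poissonMean_eq_tsum ha, ← hs.sum_add_tsum_nat_add k, add_sub_cancel_left]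
  have hs' := (summable_nat_add_iff k).2 hs
  rw [abs_of_nonneg (tsum_nonneg fun n =>
    mul_nonneg (poissonWeight_nonneg ha _) (hf _).1)]
  calc ∑' n, poissonWeight a (n + k) * f (n + k) ≤ ∑' n, a ^ k * poissonWeight a n :=
        hs'.tsum_le_tsum (fun n => (mul_le_of_le_one_right (poissonWeight_nonneg ha _)
          (hf _).2).trans (poissonWeight_add_le ha n k))
          ((hasSum_poissonWeight ha).summable.mul_left _)
    _ = a ^ k := by rw [tsum_mul_left, (hasSum_poissonWeight ha).tsum_eq, mul_one]

lemma abs_exp_neg_sub_le {a : ℝ} (ha : 0 ≤ a) (ha1 : a ≤ 1) :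
    |Real.exp (-a) - (1 - a)| ≤ a ^ 2 := by
  have := Real.abs_exp_sub_one_sub_id_le (x := -a) (by rw [abs_neg, abs_of_nonneg ha]; exact ha1)
  rw [neg_sq] at this
  convert this using 2; ring

/-- Cutting the series costs a²; replacing exp(-a) by 1 - a in the zeroth weight and by 1 in the
first costs a² each. -/
lemma abs_poissonMean_sub_two_terms_le {a : ℝ} (ha : 0 ≤ a) (ha1 : a ≤ 1) {f : ℕ → ℝ}
    (hf : ∀ n, f n ∈ Icc (0 : ℝ) 1) :
    |poissonMean f a - ((1 - a) * f 0 + a * f 1)| ≤ 3 * a ^ 2 := by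
  have h := abs_le.1 (abs_poissonMean_sub_sum_le ha hf 2)
  have he := abs_le.1 (abs_exp_neg_sub_le ha ha1)
  have he1 : Real.exp (-a) ≤ 1 := Real.exp_le_one_iff.2 (by linarith)
  have hw : ∑ n ∈ Finset.range 2, poissonWeight a n * f n =
      Real.exp (-a) * f 0 + a * Real.exp (-a) * f 1 := by
    simp only [Finset.sum_range_succ, Finset.sum_range_zero, poissonWeight, Nat.factorial,
      Nat.cast_one, mul_one, pow_zero, div_one, zero_add, pow_one]
    ring
  rw [hw] at h
  obtain ⟨h00, h01⟩ := hf 0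
  obtain ⟨h10, h11⟩ := hf 1
  have e0 : |(Real.exp (-a) - (1 - a)) * f 0| ≤ a ^ 2 := by
    rw [abs_mul, abs_of_nonneg h00]
    exact (mul_le_of_le_one_right (abs_nonneg _) h01).trans (abs_le.2 he)
  have e1 : |(1 - Real.exp (-a)) * a * f 1| ≤ a ^ 2 := by
    rw [abs_of_nonneg (mul_nonneg (mul_nonneg (by linarith) ha) h10)]
    have : (1 - Real.exp (-a)) * a ≤ a * a :=
      mul_le_mul_of_nonneg_right (by linarith [Real.one_sub_le_exp_neg a]) ha
    calc _ ≤ (1 - Real.exp (-a)) * a :=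
          mul_le_of_le_one_right (mul_nonneg (by linarith) ha) h11
      _ ≤ a ^ 2 := by rw [sq]; exact this
  rw [abs_le] at e0 e1 ⊢
  constructor <;> linarith [h.1, h.2, e0.1, e0.2, e1.1, e1.2]

/-- Since f 0 = 0, every remaining weight carries a factor a, so the first-order expansion of
exp(-a) already leaves an error of order a³. -/
lemma abs_poissonMean_sub_three_terms_le {a : ℝ} (ha : 0 ≤ a) (ha1 : a ≤ 1) {f : ℕ → ℝ}
    (hf : ∀ n, f n ∈ Icc (0 : ℝ) 1) (hf0 : f 0 = 0) :
    |poissonMean f a - (a * f 1 + a ^ 2 * (f 2 / 2 - f 1))| ≤ 3 * a ^ 3 := by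
  have h := abs_le.1 (abs_poissonMean_sub_sum_le ha hf 3)
  have he := abs_exp_neg_sub_le ha ha1
  have he1 : Real.exp (-a) ≤ 1 := Real.exp_le_one_iff.2 (by linarith)
  have hw : ∑ n ∈ Finset.range 3, poissonWeight a n * f n =
      a * Real.exp (-a) * f 1 + a ^ 2 * Real.exp (-a) * (f 2 / 2) := by
    simp [Finset.sum_range_succ, poissonWeight, hf0, Nat.factorial]; ring
  rw [hw] at h
  obtain ⟨h10, h11⟩ := hf 1
  obtain ⟨h20, h21⟩ := hf 2
  have e0 : |a * (Real.exp (-a) - (1 - a)) * f 1| ≤ a ^ 3 := by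
    rw [abs_mul, abs_of_nonneg h10, abs_mul, abs_of_nonneg ha]
    calc _ ≤ a * |Real.exp (-a) - (1 - a)| :=
          mul_le_of_le_one_right (mul_nonneg ha (abs_nonneg _)) h11
      _ ≤ a * a ^ 2 := by gcongr
      _ = a ^ 3 := by ring
  have e1 : |(1 - Real.exp (-a)) * a ^ 2 * (f 2 / 2)| ≤ a ^ 3 := by
    have h0 : 0 ≤ (1 - Real.exp (-a)) * a ^ 2 := mul_nonneg (by linarith) (sq_nonneg a)
    rw [abs_of_nonneg (mul_nonneg h0 (by linarith))]
    calc _ ≤ (1 - Real.exp (-a)) * a ^ 2 := mul_le_of_le_one_right h0 (by linarith)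
      _ ≤ a * a ^ 2 :=
          mul_le_mul_of_nonneg_right (by linarith [Real.one_sub_le_exp_neg a]) (sq_nonneg a)
      _ = a ^ 3 := by ring
  rw [abs_le] at e0 e1 ⊢
  constructor <;> linarith [h.1, h.2, e0.1, e0.2, e1.1, e1.2]

/-! ### The two-point retention probability -/

/-- The probability that two points are both retained when their balls have normalized overlap
`w`, each ball has mean count `m`, and each of the two points sees `e` fixed neighbours. -/
noncomputable def pairRetention (p : ℕ → ℝ) (m : ℝ) (e : ℕ) (w : ℝ) : ℝ :=
  poissonMean (fun i => poissonMean (fun j => p (e + i + j)) (m * (1 - w)) ^ 2) (m * w)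

section pairRetention

variable {p : ℕ → ℝ} {m w : ℝ}

lemma sq_mem_Icc {x : ℝ} (hx : x ∈ Icc (0 : ℝ) 1) : x ^ 2 ∈ Icc (0 : ℝ) 1 :=
  ⟨sq_nonneg x, pow_le_one₀ hx.1 hx.2⟩

/-- Both Poisson means are expanded to first order. The inner mean at i = 0 is needed up to its
linear term; at i = 1 the outer weight m * w is already of order m, so there the inner mean may be
replaced by its leading value. -/
lemma abs_pairRetention_sub_le (hp : ∀ n, p n ∈ Icc (0 : ℝ) 1) (e : ℕ) (hm : 0 ≤ m) (hm1 : m ≤ 1)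
    (hw : w ∈ Icc (0 : ℝ) 1) :
    |pairRetention p m e w - (p e ^ 2 * (1 - m * w) + 2 * m * (1 - w) * p e * (p (e + 1) - p e)
      + m * w * p (e + 1) ^ 2)| ≤ 20 * m ^ 2 := by
  obtain ⟨hw0, hw1⟩ := hw
  have hu0 : 0 ≤ m * w := mul_nonneg hm hw0
  have hum : m * w ≤ m := mul_le_of_le_one_right hm hw1
  have hv0 : 0 ≤ m * (1 - w) := mul_nonneg hm (by linarith)
  have hvm : m * (1 - w) ≤ m := mul_le_of_le_one_right hm (by linarith)
  have hG : ∀ i, poissonMean (fun j => p (e + i + j)) (m * (1 - w)) ∈ Icc (0 : ℝ) 1 := fun i =>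
    poissonMean_mem_Icc hv0 fun _ => hp _
  have h1 := abs_poissonMean_sub_two_terms_le hu0 (hum.trans hm1)
    (f := fun i => poissonMean (fun j => p (e + i + j)) (m * (1 - w)) ^ 2)
    (fun i => sq_mem_Icc (hG i))
  have h2 := abs_poissonMean_sub_two_terms_le hv0 (hvm.trans hm1)
    (f := fun j => p (e + 0 + j)) (fun _ => hp _)
  have h3 := abs_poissonMean_sub_two_terms_le hv0 (hvm.trans hm1)
    (f := fun j => p (e + 1 + j)) (fun _ => hp _)
  change |pairRetention p m e w - _| ≤ _ at h1
  have hG0 := hG 0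
  have hG1 := hG 1
  generalize poissonMean (fun j => p (e + 0 + j)) (m * (1 - w)) = G0 at *
  generalize poissonMean (fun j => p (e + 1 + j)) (m * (1 - w)) = G1 at *
  generalize pairRetention p m e w = H at *
  simp only [add_zero] at h2 h3
  obtain ⟨a0, a1⟩ := hp e
  obtain ⟨b0, b1⟩ := hp (e + 1)
  obtain ⟨c0, c1⟩ := hp (e + 1 + 1)
  generalize p e = a at *
  generalize p (e + 1) = b at *
  generalize p (e + 1 + 1) = c at *
  have hvdef : m * (1 - w) = m - m * w := by ring
  have hv2 : (m * (1 - w)) ^ 2 ≤ m ^ 2 := by gcongr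
  have hu2 : (m * w) ^ 2 ≤ m ^ 2 := by gcongr
  have hmv : 2 * m * (1 - w) = 2 * (m * (1 - w)) := by ring
  rw [hmv]
  generalize m * (1 - w) = v at *
  generalize m * w = u at *
  have hL : (1 - v) * a + v * b ∈ Icc (0 : ℝ) 1 := by
    constructor <;> nlinarith
  have k1 : |G0 ^ 2 - ((1 - v) * a + v * b) ^ 2| ≤ 6 * m ^ 2 := by
    rw [sq_sub_sq, abs_mul, mul_comm]
    have : |G0 + ((1 - v) * a + v * b)| ≤ 2 := by
      rw [abs_le]; constructor <;> linarith [hG0.1, hG0.2, hL.1, hL.2]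
    calc _ ≤ (3 * v ^ 2) * 2 := mul_le_mul h2 this (abs_nonneg _) (by positivity)
      _ ≤ 6 * m ^ 2 := by linarith
  have k2 : |G1 ^ 2 - b ^ 2| ≤ 8 * m := by
    rw [sq_sub_sq, abs_mul, mul_comm]
    have t1 : |G1 + b| ≤ 2 := by
      rw [abs_le]; constructor <;> linarith [hG1.1, hG1.2]
    have t2 : |G1 - b| ≤ 4 * m := by
      have hvv : v ^ 2 ≤ v := by nlinarith
      have : |v * (c - b)| ≤ v := by
        rw [abs_mul, abs_of_nonneg hv0]
        exact mul_le_of_le_one_right hv0 (abs_le.2 ⟨by linarith, by linarith⟩)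
      rw [abs_le] at this h3 ⊢
      constructor <;> linarith [this.1, this.2, h3.1, h3.2]
    calc _ ≤ (4 * m) * 2 := mul_le_mul t2 t1 (abs_nonneg _) (by positivity)
      _ = 8 * m := by ring
  have k3 : |u * (G1 ^ 2 - b ^ 2)| ≤ 8 * m ^ 2 := by
    rw [abs_mul, abs_of_nonneg hu0]
    calc _ ≤ m * (8 * m) := mul_le_mul hum k2 (abs_nonneg _) hm
      _ = 8 * m ^ 2 := by ring
  have k4 : |(1 - u) * (G0 ^ 2 - ((1 - v) * a + v * b) ^ 2)| ≤ 6 * m ^ 2 := by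
    rw [abs_mul, abs_of_nonneg (by linarith)]
    exact (mul_le_of_le_one_left (abs_nonneg _) (by linarith)).trans k1
  have hba : |b - a| ≤ 1 := abs_le.2 ⟨by linarith, by linarith⟩
  have k5 : |(1 - u) * (v ^ 2 * (b - a) ^ 2)| ≤ m ^ 2 := by
    rw [abs_of_nonneg (mul_nonneg (by linarith) (by positivity))]
    have : (b - a) ^ 2 ≤ 1 := (sq_le_one_iff_abs_le_one _).2 hba
    calc _ ≤ v ^ 2 * (b - a) ^ 2 := mul_le_of_le_one_left (by positivity) (by linarith)
      _ ≤ v ^ 2 := mul_le_of_le_one_right (by positivity) this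
      _ ≤ m ^ 2 := hv2
  have k6 : |u * (2 * v * a * (b - a))| ≤ 2 * m ^ 2 := by
    have : u * (2 * v * a * (b - a)) = 2 * (u * v) * (a * (b - a)) := by ring
    rw [this, abs_mul, abs_of_nonneg (by positivity)]
    have t : |a * (b - a)| ≤ 1 := by
      rw [abs_mul, abs_of_nonneg a0]; exact mul_le_one₀ a1 (abs_nonneg _) hba
    calc _ ≤ 2 * (u * v) := mul_le_of_le_one_right (by positivity) t
      _ ≤ 2 * (m * m) := by gcongr
      _ = _ := by ring
  -- The constant is 20 = 3 + 6 + 8 + 1 + 2: the outer truncation, the two inner replacements, and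
  -- the second-order terms v² and u v left after expanding (1 - u)(a + v(b - a))².
  rw [abs_le] at h1 k3 k4 k5 k6 ⊢
  constructor <;> linarith [h1.1, h1.2, k3.1, k3.2, k4.1, k4.2, k5.1, k5.2, k6.1, k6.2]

/-- Weierstrass M-test: on s the terms are dominated by M^n / n!. -/
lemma continuousOn_tsum_poissonWeight_mul {s : Set ℝ} {α : ℝ → ℝ} {f : ℕ → ℝ → ℝ} {M : ℝ}
    (hα : ContinuousOn α s) (hα0 : ∀ x ∈ s, 0 ≤ α x) (hαM : ∀ x ∈ s, α x ≤ M)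
    (hf : ∀ n, ContinuousOn (f n) s) (hf1 : ∀ n, ∀ x ∈ s, f n x ∈ Icc (0 : ℝ) 1) :
    ContinuousOn (fun x => poissonMean (fun n => f n x) (α x)) s := by
  have hc : ∀ n, ContinuousOn (fun x => poissonWeight (α x) n * f n x) s := fun n => by
    have h1 : ContinuousOn (fun x => Real.exp (-α x) * α x ^ n) s := by fun_prop
    have h2 : ContinuousOn (fun x => poissonWeight (α x) n) s := h1.div_const (n.factorial : ℝ)
    exact h2.mul (hf n)
  have : ContinuousOn (fun x => ∑' n, poissonWeight (α x) n * f n x) s := by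
    have hs : Summable fun n : ℕ => M ^ n / (n.factorial : ℝ) := Real.summable_pow_div_factorial M
    refine continuousOn_tsum hc hs fun n x hx => ?_
    have h0 := poissonWeight_nonneg (hα0 x hx) n
    rw [Real.norm_eq_abs, abs_of_nonneg (mul_nonneg h0 (hf1 n x hx).1)]
    refine (mul_le_of_le_one_right h0 (hf1 n x hx).2).trans ?_
    have h2 := hα0 x hx
    have h1 : Real.exp (-α x) ≤ 1 := Real.exp_le_one_iff.2 (by linarith)
    have h3 : Real.exp (-α x) * α x ^ n ≤ M ^ n :=
      (mul_le_of_le_one_left (pow_nonneg h2 n) h1).trans (pow_le_pow_left₀ h2 (hαM x hx) n)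
    exact div_le_div_of_nonneg_right h3 (Nat.cast_nonneg _)
  exact this.congr fun x hx => poissonMean_eq_tsum (hα0 x hx) _

lemma continuousOn_pairRetention (hp : ∀ n, p n ∈ Icc (0 : ℝ) 1) (e : ℕ) (hm : 0 ≤ m) :
    ContinuousOn (pairRetention p m e) (Icc 0 1) := by
  refine continuousOn_tsum_poissonWeight_mul (M := m) (by fun_prop)
    (fun x hx => mul_nonneg hm hx.1) (fun x hx => mul_le_of_le_one_right hm hx.2) (fun n => ?_)
    fun n x hx => sq_mem_Icc <|
      poissonMean_mem_Icc (mul_nonneg hm (by linarith [hx.2])) fun _ => hp _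
  refine ContinuousOn.pow ?_ 2
  exact continuousOn_tsum_poissonWeight_mul (M := m) (by fun_prop)
    (fun x hx => mul_nonneg hm (by linarith [hx.2]))
    (fun x hx => mul_le_of_le_one_right hm (by linarith [hx.1])) (fun _ => continuousOn_const)
    fun _ _ _ => hp _

end pairRetention

/-! ### Expansion of the normalised ratio -/

section expansion

variable {m n c b w H : ℝ}

/-- Here n stands for the mean divided by m. The condition m ≤ c / 8 gives 4m ≤ c / 2, which keeps
n, and later the denominators, away from zero. -/
lemma abs_normalizedMean_bounds (hm : 0 < m) (hc1 : c ≤ 1) (hmc : m ≤ c / 8)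
    (hb : b ∈ Icc (0 : ℝ) 1) (hn : |n - (c + m * (b / 2 - c))| ≤ 3 * m ^ 2) :
    |n - c| ≤ 4 * m ∧ c / 2 ≤ n ∧ n ≤ 2 := by
  have h1 : |m * (b / 2 - c)| ≤ m := by
    rw [abs_mul, abs_of_pos hm]
    exact mul_le_of_le_one_right hm.le (abs_le.2 ⟨by linarith [hb.1], by linarith [hb.2]⟩)
  have h2 : m ^ 2 ≤ m := by nlinarith
  rw [abs_le] at h1 hn
  have : |n - c| ≤ 4 * m := abs_le.2 ⟨by linarith [h1.1, hn.1], by linarith [h1.2, hn.2]⟩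
  rw [abs_le] at this
  exact ⟨abs_le.2 this, by linarith [this.1], by linarith [this.2]⟩

/-- Only the leading term of n matters: replacing c² by n² costs 12 m², added to the given 20 m².
The bound n ≥ c / 2 turns 32 into 128 / c². -/
lemma abs_div_sub_le_far (hm : 0 < m) (hc : 0 < c) (hc1 : c ≤ 1) (hmc : m ≤ c / 8)
    (hb : b ∈ Icc (0 : ℝ) 1) (hn : |n - (c + m * (b / 2 - c))| ≤ 3 * m ^ 2)
    (hw : w ∈ Icc (0 : ℝ) 1) (hH : |H - m * w * c ^ 2| ≤ 20 * m ^ 2) :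
    |H / (m * n) ^ 2 - w / m| ≤ 128 / c ^ 2 := by
  obtain ⟨h1, h2, h3⟩ := abs_normalizedMean_bounds hm hc1 hmc hb hn
  have hn0 : 0 < n := by linarith
  have hk : |m * w * (n ^ 2 - c ^ 2)| ≤ 12 * m ^ 2 := by
    have : |n + c| ≤ 3 := abs_le.2 ⟨by linarith, by linarith⟩
    rw [sq_sub_sq, abs_mul (m * w), abs_mul (n + c), abs_of_nonneg (mul_nonneg hm.le hw.1)]
    calc _ ≤ m * (3 * (4 * m)) := mul_le_mul (mul_le_of_le_one_right hm.le hw.2)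
          (mul_le_mul this h1 (abs_nonneg _) (by norm_num)) (by positivity) hm.le
      _ = 12 * m ^ 2 := by ring
  have hN : |H - m * w * n ^ 2| ≤ 32 * m ^ 2 := by
    rw [abs_le] at hk hH ⊢
    constructor <;> linarith [hk.1, hk.2, hH.1, hH.2]
  have he : H / (m * n) ^ 2 - w / m = (H - m * w * n ^ 2) / (m * n) ^ 2 := by
    field_simp
  rw [he, abs_div, abs_of_nonneg (sq_nonneg (m * n))]
  calc _ ≤ 32 * m ^ 2 / (m * (c / 2)) ^ 2 := by gcongr
    _ = 128 / c ^ 2 := by field_simp; norm_num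

/-- The numerator and n² are both needed to first order in m. With K as the bracket, n² (1 + mK) and
the expansion of H agree up to order m, because c² K = bc + w(c - b)². -/
lemma abs_div_sub_le_near (hm : 0 < m) (hc : 0 < c) (hc1 : c ≤ 1) (hmc : m ≤ c / 8)
    (hb : b ∈ Icc (0 : ℝ) 1) (hn : |n - (c + m * (b / 2 - c))| ≤ 3 * m ^ 2)
    (hw : w ∈ Icc (0 : ℝ) 1)
    (hH : |H - (c ^ 2 * (1 - m * w) + 2 * m * (1 - w) * c * (b - c) + m * w * b ^ 2)|
      ≤ 20 * m ^ 2) :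
    |H / (m * n) ^ 2 - 1 / m ^ 2 * (1 + m * (b / c + w * (1 - b / c) ^ 2))|
      ≤ (33 + 15 * (2 / c ^ 2)) * 4 / c ^ 2 := by
  obtain ⟨h1, h2, h3⟩ := abs_normalizedMean_bounds hm hc1 hmc hb hn
  have hn0 : 0 < n := by linarith
  obtain ⟨hb0, hb1⟩ := hb
  obtain ⟨hw0, hw1⟩ := hw
  set K : ℝ := b / c + w * (1 - b / c) ^ 2 with hK
  have hKc : c ^ 2 * K = b * c + w * (c - b) ^ 2 := by rw [hK]; field_simp
  have hK0 : 0 ≤ K := by positivity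
  have hK2 : K ≤ 2 / c ^ 2 := by
    rw [le_div_iff₀ (by positivity), mul_comm, hKc]
    have t1 : b * c ≤ 1 := mul_le_one₀ hb1 hc.le hc1
    have t2 : (c - b) ^ 2 ≤ 1 :=
      (sq_le_one_iff_abs_le_one _).2 (abs_le.2 ⟨by linarith, by linarith⟩)
    have t3 : w * (c - b) ^ 2 ≤ 1 := mul_le_one₀ hw1 (sq_nonneg _) t2
    linarith
  have hd : |b / 2 - c| ≤ 1 := abs_le.2 ⟨by linarith, by linarith⟩
  have hmd : |m * (b / 2 - c)| ≤ m := by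
    rw [abs_mul, abs_of_pos hm]; exact mul_le_of_le_one_right hm.le hd
  -- Squaring the expansion of n: 12 m² from its error, via a difference of squares, and m² from the
  -- square of its linear term.
  have hA : |n ^ 2 - (c ^ 2 + m * (c * b - 2 * c ^ 2))| ≤ 13 * m ^ 2 := by
    have t1 : |(n + (c + m * (b / 2 - c))) * (n - (c + m * (b / 2 - c)))| ≤ 4 * (3 * m ^ 2) := by
      rw [abs_mul]
      refine mul_le_mul ?_ hn (abs_nonneg _) (by norm_num)
      rw [abs_le] at hmd ⊢
      constructor <;> linarith [hmd.1, hmd.2]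
    have t2 : |(m * (b / 2 - c)) ^ 2| ≤ m ^ 2 := by
      rw [abs_pow]; exact pow_le_pow_left₀ (abs_nonneg _) hmd 2
    rw [abs_le] at t1 t2 ⊢
    constructor <;> linarith [t1.1, t1.2, t2.1, t2.2]
  have hmK : 0 ≤ 1 + m * K := by positivity
  have hm1 : m ≤ 1 := by linarith
  have hB : |(n ^ 2 - (c ^ 2 + m * (c * b - 2 * c ^ 2))) * (1 + m * K)|
      ≤ 13 * m ^ 2 * (1 + K) := by
    rw [abs_mul, abs_of_nonneg hmK]
    refine mul_le_mul hA ?_ hmK (by positivity)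
    linarith [mul_le_of_le_one_left hK0 hm1]
  have hC : |m ^ 2 * K * (c * b - 2 * c ^ 2)| ≤ m ^ 2 * K * 2 := by
    rw [abs_mul, abs_of_nonneg (by positivity)]
    refine mul_le_mul_of_nonneg_left ?_ (by positivity)
    have t1 : c * b ≤ 1 := mul_le_one₀ hc1 hb0 hb1
    have t2 : c ^ 2 ≤ 1 := pow_le_one₀ hc.le hc1
    have t3 : 0 ≤ c * b := by positivity
    have t4 : 0 ≤ c ^ 2 := by positivity
    exact abs_le.2 ⟨by linarith, by linarith⟩
  -- The terms are 20 from H, 13(1 + K) from n², and 2K from the product of the two linear terms.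
  have hN : |H - n ^ 2 * (1 + m * K)| ≤ (33 + 15 * K) * m ^ 2 := by
    have e : H - n ^ 2 * (1 + m * K) =
        (H - (c ^ 2 * (1 - m * w) + 2 * m * (1 - w) * c * (b - c) + m * w * b ^ 2))
        - (n ^ 2 - (c ^ 2 + m * (c * b - 2 * c ^ 2))) * (1 + m * K)
        - m ^ 2 * K * (c * b - 2 * c ^ 2) := by linear_combination (-m) * hKc
    rw [e]
    rw [abs_le] at hH hB hC ⊢
    constructor <;> linarith [hH.1, hH.2, hB.1, hB.2, hC.1, hC.2]
  have he : H / (m * n) ^ 2 - 1 / m ^ 2 * (1 + m * K) =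
      (H - n ^ 2 * (1 + m * K)) / (m * n) ^ 2 := by field_simp
  rw [he, abs_div, abs_of_nonneg (sq_nonneg (m * n))]
  calc _ ≤ (33 + 15 * (2 / c ^ 2)) * m ^ 2 / (m * (c / 2)) ^ 2 := by
        gcongr
        exact hN.trans (by gcongr)
    _ = _ := by field_simp; norm_num

end expansion

/-! ### The Mecke formula for independent Poisson counts -/

section cells

open scoped ENNReal NNReal

variable {ι : Type*} [Fintype ι] [DecidableEq ι]

/-- This recursion is the source of the Mecke formula: weighting by the count is the same as adding
one point. -/
lemma poissonMeasure_succ_mul (r : ℝ≥0) (n : ℕ) :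
    ((n + 1 : ℕ) : ℝ≥0∞) * poissonMeasure r {n + 1} = r * poissonMeasure r {n} := by
  rw [poissonMeasure_singleton, poissonMeasure_singleton, ← ENNReal.ofReal_natCast,
    ← ENNReal.ofReal_coe_nnreal, ← ENNReal.ofReal_mul (by positivity),
    ← ENNReal.ofReal_mul (by positivity)]
  congr 1
  rw [Nat.factorial_succ, pow_succ]
  push_cast
  field_simp

/-- The sum over the points of a configuration with cell counts `n` of a function of the cell of
the point and of the cell counts of the remaining points. -/
noncomputable def reducedSum (F : ι → (ι → ℕ) → ℝ≥0∞) (n : ι → ℕ) : ℝ≥0∞ :=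
  ∑ a, (n a : ℝ≥0∞) * F a (n - Pi.single a 1)

lemma lintegral_pi_poissonMeasure_mul (r : ι → ℝ≥0) (a : ι) (G : (ι → ℕ) → ℝ≥0∞) :
    ∫⁻ n, (n a : ℝ≥0∞) * G (n - Pi.single a 1) ∂(Measure.pi fun b => poissonMeasure (r b))
      = r a * ∫⁻ n, G n ∂(Measure.pi fun b => poissonMeasure (r b)) := by
  rw [lintegral_countable', lintegral_countable', ← ENNReal.tsum_mul_left]
  -- Terms with n a = 0 vanish, so the sum runs over the range of the shift by the unit vector at a.
  have hinj : Function.Injective fun n : ι → ℕ => n + Pi.single a 1 := add_left_injective _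
  rw [← hinj.tsum_eq]
  · refine tsum_congr fun n => ?_
    rw [Measure.pi_singleton, Measure.pi_singleton, add_tsub_cancel_right,
      ← Finset.mul_prod_erase _ _ (Finset.mem_univ a),
      ← Finset.mul_prod_erase _ (fun b => poissonMeasure (r b) {n b}) (Finset.mem_univ a)]
    have h1 : ∏ b ∈ Finset.univ.erase a, poissonMeasure (r b) {(n + Pi.single a 1 : ι → ℕ) b} =
        ∏ b ∈ Finset.univ.erase a, poissonMeasure (r b) {n b} :=
      Finset.prod_congr rfl fun b hb => by
        simp [Pi.single_eq_of_ne (Finset.ne_of_mem_erase hb)]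
    rw [h1]
    have h2 := poissonMeasure_succ_mul (r a) (n a)
    simp only [Pi.add_apply, Pi.single_eq_same]
    calc _ = (((n a + 1 : ℕ) : ℝ≥0∞) * poissonMeasure (r a) {n a + 1}) * (G n *
          ∏ b ∈ Finset.univ.erase a, poissonMeasure (r b) {n b}) := by ring
      _ = _ := by rw [h2]; ring
  · intro n hn
    have h0 : n a ≠ 0 := fun h => hn (by simp [h])
    refine ⟨n - Pi.single a 1, ?_⟩
    refine tsub_add_cancel_of_le fun b => ?_
    by_cases hb : b = a
    · subst hb; simpa using Nat.one_le_iff_ne_zero.2 h0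
    · simp [Pi.single_eq_of_ne hb]

lemma lintegral_reducedSum (r : ι → ℝ≥0) (F : ι → (ι → ℕ) → ℝ≥0∞) :
    ∫⁻ n, reducedSum F n ∂(Measure.pi fun b => poissonMeasure (r b))
      = ∑ a, r a * ∫⁻ n, F a n ∂(Measure.pi fun b => poissonMeasure (r b)) := by
  simp only [reducedSum]
  rw [lintegral_finsetSum _ fun a _ => measurable_of_countable _]
  exact Finset.sum_congr rfl fun a _ => lintegral_pi_poissonMeasure_mul r a (F a)

variable {α : Type*} [DecidableEq α]

/-- The number of points of `T` in each cell. -/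
def cellCount (q : α → ι) (T : Finset α) : ι → ℕ := fun a => (T.filter fun x => q x = a).card

lemma cellCount_erase {ι : Type*} [DecidableEq ι] (q : α → ι) {T : Finset α} {x : α} (hx : x ∈ T) :
    cellCount q (T.erase x) = cellCount q T - Pi.single (q x) 1 := by
  funext a
  simp only [cellCount, Pi.sub_apply]
  rw [Finset.filter_erase]
  by_cases h : q x = a
  · subst h
    rw [Finset.card_erase_of_mem (by simp [hx])]
    simp
  · rw [Finset.erase_eq_of_notMem (by simp [h]), Pi.single_eq_of_ne (Ne.symm h), tsub_zero]

/-- Points of one cell contribute equally, so the sum over points depends on the configuration only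
through the cell counts, whose law is known. -/
lemma sum_eq_reducedSum (q : α → ι) (T : Finset α) (F : ι → (ι → ℕ) → ℝ≥0∞) :
    ∑ x ∈ T, F (q x) (cellCount q (T.erase x)) = reducedSum F (cellCount q T) := by
  rw [reducedSum, ← Finset.sum_fiberwise T q]
  refine Finset.sum_congr rfl fun a _ => ?_
  rw [← nsmul_eq_mul]
  refine Finset.sum_eq_card_nsmul fun x hx => ?_
  obtain ⟨hxT, hxa⟩ := Finset.mem_filter.1 hx
  rw [cellCount_erase q hxT, hxa]

lemma card_filter_comp_eq_sum_cellCount {α : Type*} (q : α → ι) (T : Finset α) (R : ι → Prop)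
    [DecidablePred R] :
    (T.filter fun x => R (q x)).card = ∑ a with R a, cellCount q T a := by
  rw [Finset.card_eq_sum_card_fiberwise (f := q) (t := Finset.univ.filter R)
    (fun x hx => by simpa using (Finset.mem_filter.1 hx).2)]
  refine Finset.sum_congr rfl fun a ha => ?_
  rw [cellCount, Finset.filter_filter]
  congr 1
  refine Finset.filter_congr fun x _ => ⟨fun h => h.2, fun h => ⟨?_, h⟩⟩
  rw [h]; exact (Finset.mem_filter.1 ha).2

end cells

/-! ### The Mecke formula for cell counts of the Poisson process -/

section discreteMecke

open scoped ENNReal NNReal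

variable {d : ℕ} {Ω : Type*} [MeasurableSpace Ω] {P : Measure Ω}
  {lam : ℝ} {X : Ω → Set (RSpace d)}

lemma IsPointProcess.measurable_ncard (hX : IsPointProcess X) {B : Set (RSpace d)}
    (hB : MeasurableSet B) : Measurable fun ω => (X ω ∩ B).ncard :=
  (measurable_of_countable ENat.toNat).comp (hX.measurable_count B hB)

lemma IsPoissonProcess.map_counts [IsProbabilityMeasure P] (hX : IsPoissonProcess P lam X)
    {ι : Type*} [Fintype ι]
    (Z : ι → Set (RSpace d)) (hZ : ∀ a, MeasurableSet (Z a)) (hZb : ∀ a, Bornology.IsBounded (Z a))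
    (hZd : ∀ a b, a ≠ b → Disjoint (Z a) (Z b)) :
    P.map (fun ω a => (X ω ∩ Z a).ncard) =
      Measure.pi fun a => poissonMeasure (lam * volume.real (Z a)).toNNReal := by
  have e := Fintype.equivFin ι
  have h := hX.indep_count (Fintype.card ι) (fun i => Z (e.symm i)) (fun _ => hZ _)
    (fun _ => hZb _) fun i j hij => hZd _ _ (e.symm.injective.ne hij)
  have h' := h.precomp e.injective
  simp only [Equiv.symm_apply_apply] at h'
  rw [(iIndepFun_iff_map_fun_eq_pi_map fun a =>
    (hX.isPointProcess.measurable_ncard (hZ a)).aemeasurable).1 h']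
  congr 1
  funext a
  exact hX.law_count _ (hZ a) (hZb a)

lemma cellCount_eq_ncard {Ω ι : Type*} [DecidableEq ι] {X : Ω → Set (RSpace d)}
    {W : Set (RSpace d)} {T : Ω → Finset (RSpace d)} {q : RSpace d → ι}
    (hT : ∀ ω, (T ω : Set (RSpace d)) = X ω ∩ W) (ω : Ω) :
    cellCount q (T ω) = fun a => (X ω ∩ (W ∩ q ⁻¹' {a})).ncard := by
  funext a
  rw [cellCount, ← Set.ncard_coe_finset, Finset.coe_filter, ← Set.inter_assoc, ← hT]
  congr 1

variable {ι : Type*} [Fintype ι] [DecidableEq ι] [MeasurableSpace ι] [MeasurableSingletonClass ι]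
  {W : Set (RSpace d)} {T : Ω → Finset (RSpace d)} {q : RSpace d → ι}

open scoped Classical in
/-- The one-point Mecke formula for functionals of finitely many cell counts. -/
theorem IsPoissonProcess.lintegral_sum_cells [IsProbabilityMeasure P]
    (hX : IsPoissonProcess P lam X) (hlam : 0 ≤ lam)
    (hW : MeasurableSet W) (hWb : Bornology.IsBounded W)
    (hT : ∀ ω, (T ω : Set (RSpace d)) = X ω ∩ W) (hq : Measurable q)
    (F : ι → (ι → ℕ) → ℝ≥0∞) :
    ∫⁻ ω, ∑ x ∈ T ω, F (q x) (cellCount q ((T ω).erase x)) ∂P =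
      ENNReal.ofReal lam * ∫⁻ x in W, ∫⁻ ω, F (q x) (cellCount q (T ω)) ∂P := by
  have hZ : ∀ a, MeasurableSet (W ∩ q ⁻¹' {a}) := fun a =>
    hW.inter (hq (measurableSet_singleton a))
  have hZb : ∀ a, Bornology.IsBounded (W ∩ q ⁻¹' {a}) := fun a => hWb.subset inter_subset_left
  have hlaw := hX.map_counts (fun a => W ∩ q ⁻¹' {a}) hZ hZb fun a b hab =>
    Set.disjoint_left.2 fun x hx hx' => hab (hx.2.symm.trans hx'.2)
  have hmeas : Measurable fun ω a => (X ω ∩ (W ∩ q ⁻¹' {a})).ncard :=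
    measurable_pi_lambda _ fun a => hX.isPointProcess.measurable_ncard (hZ a)
  simp_rw [sum_eq_reducedSum, cellCount_eq_ncard hT]
  have hint : ∀ G : (ι → ℕ) → ℝ≥0∞, ∫⁻ ω, G (fun a => (X ω ∩ (W ∩ q ⁻¹' {a})).ncard) ∂P =
      ∫⁻ n, G n ∂Measure.pi fun a =>
        poissonMeasure (lam * volume.real (W ∩ q ⁻¹' {a})).toNNReal := fun G => by
    rw [← hlaw, lintegral_map (measurable_of_countable _) hmeas]
  simp_rw [hint]
  rw [lintegral_reducedSum]
  have hW' : ∀ φ : ι → ℝ≥0∞, ∫⁻ x in W, φ (q x) = ∑ a, volume (W ∩ q ⁻¹' {a}) * φ a := fun φ => by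
    rw [← lintegral_map (measurable_of_countable φ) hq, lintegral_fintype]
    refine Finset.sum_congr rfl fun a _ => ?_
    rw [Measure.map_apply hq (measurableSet_singleton a),
      Measure.restrict_apply (hq (measurableSet_singleton a)), mul_comm, inter_comm]
  rw [hW' fun a => ∫⁻ n, F a n ∂_, Finset.mul_sum]
  refine Finset.sum_congr rfl fun a _ => ?_
  rw [← mul_assoc]
  congr 1
  -- The coercion of `Real.toNNReal` is `ENNReal.ofReal` by definition, so the Poisson parameter of
  -- the cell becomes lam times its volume.
  rw [← ENNReal.ofReal, ENNReal.ofReal_mul hlam, ofReal_measureReal (hZb a).measure_lt_top.ne]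

end discreteMecke

/-! ### Passage from cell counts to ball counts -/

section continuumMecke

open scoped ENNReal NNReal Topology
open Filter

lemma sum_cellCount {α ι : Type*} [Fintype ι] [DecidableEq ι] (q : α → ι) (S : Finset α) :
    ∑ a, cellCount q S a = S.card :=
  (Finset.card_eq_sum_card_fiberwise fun _ _ => Finset.mem_univ _).symm

variable {d : ℕ} {Ω : Type*} [MeasurableSpace Ω] {P : Measure Ω}
  {lam : ℝ} {X : Ω → Set (RSpace d)} {W : Set (RSpace d)} {T : Ω → Finset (RSpace d)}

lemma IsPointProcess.measurable_cellCount (hX : IsPointProcess X) (hW : MeasurableSet W)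
    (hT : ∀ ω, (T ω : Set (RSpace d)) = X ω ∩ W)
    {ι : Type*} [DecidableEq ι] [MeasurableSpace ι] [MeasurableSingletonClass ι]
    {q : RSpace d → ι} (hq : Measurable q) : Measurable fun ω => cellCount q (T ω) := by
  simp_rw [cellCount_eq_ncard hT]
  exact measurable_pi_lambda _ fun a =>
    hX.measurable_ncard (hW.inter (hq (measurableSet_singleton a)))

lemma IsPointProcess.measurable_card (hX : IsPointProcess X) (hW : MeasurableSet W)
    (hT : ∀ ω, (T ω : Set (RSpace d)) = X ω ∩ W) : Measurable fun ω => (T ω).card := by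
  simp_rw [← Set.ncard_coe_finset, hT]
  exact hX.measurable_ncard hW

open scoped Classical in
-- The case of a single cell. It supplies the integrable majorant for the limit below and the mean
-- number of points in W.
lemma IsPoissonProcess.lintegral_sum_card [IsProbabilityMeasure P]
    (hX : IsPoissonProcess P lam X) (hlam : 0 ≤ lam)
    (hW : MeasurableSet W) (hWb : Bornology.IsBounded W)
    (hT : ∀ ω, (T ω : Set (RSpace d)) = X ω ∩ W) (k : ℕ → ℝ≥0∞) :
    ∫⁻ ω, ∑ x ∈ T ω, k ((T ω).erase x).card ∂P =
      ENNReal.ofReal lam * (volume W * ∫⁻ ω, k (T ω).card ∂P) := by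
  have h := hX.lintegral_sum_cells (q := fun _ => ()) hlam hW hWb hT measurable_const
    fun a m => k (∑ c, m c)
  simp only [sum_cellCount] at h
  rw [h, setLIntegral_const, mul_comm (volume W)]

open scoped Classical in
/-- The one-point Mecke formula passes to limits of functionals of cell counts. -/
theorem IsPoissonProcess.lintegral_sum_of_eventually_eq [IsProbabilityMeasure P]
    (hX : IsPoissonProcess P lam X) (hlam : 0 ≤ lam)
    (hW : MeasurableSet W) (hWb : Bornology.IsBounded W)
    (hT : ∀ ω, (T ω : Set (RSpace d)) = X ω ∩ W)
    {k : ℕ → ℝ≥0∞} (hk : ∫⁻ ω, k (T ω).card ∂P ≠ ∞)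
    {ι : ℕ → Type} [∀ n, Fintype (ι n)] [∀ n, DecidableEq (ι n)] [∀ n, MeasurableSpace (ι n)]
    [∀ n, MeasurableSingletonClass (ι n)]
    {q : ∀ n, RSpace d → ι n} (hq : ∀ n, Measurable (q n))
    {F : ∀ n, ι n → (ι n → ℕ) → ℝ≥0∞} (hF : ∀ n a m, F n a m ≤ k (∑ c, m c))
    {L : RSpace d → Finset (RSpace d) → ℝ≥0∞}
    (hL : ∀ x ∈ W, ∀ S : Finset (RSpace d), (S : Set (RSpace d)) ⊆ W →
      ∀ᶠ n in atTop, F n (q n x) (cellCount (q n) S) = L x S) :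
    ∫⁻ ω, ∑ x ∈ T ω, L x ((T ω).erase x) ∂P =
      ENNReal.ofReal lam * ∫⁻ x in W, ∫⁻ ω, L x (T ω) ∂P := by
  have hTW : ∀ ω, (T ω : Set (RSpace d)) ⊆ W := fun ω => (hT ω).trans_subset inter_subset_right
  have hTm := fun n => hX.isPointProcess.measurable_cellCount hW hT (hq n)
  have hFk : ∀ n a (S : Finset (RSpace d)), F n a (cellCount (q n) S) ≤ k S.card := fun n a S =>
    (hF n a _).trans_eq (by rw [sum_cellCount])
  have hl : Tendsto (fun n => ∫⁻ ω, ∑ x ∈ T ω, F n (q n x) (cellCount (q n) ((T ω).erase x)) ∂P)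
      atTop (𝓝 (∫⁻ ω, ∑ x ∈ T ω, L x ((T ω).erase x) ∂P)) := by
    refine tendsto_lintegral_of_dominated_convergence
      (fun ω => ∑ x ∈ T ω, k ((T ω).erase x).card) (fun n => ?_)
      (fun n => ae_of_all _ fun ω => Finset.sum_le_sum fun x _ => hFk n _ _) ?_
      (ae_of_all _ fun ω => ?_)
    · simp_rw [sum_eq_reducedSum]
      exact (measurable_of_countable (reducedSum (F n))).comp (hTm n)
    · rw [hX.lintegral_sum_card hlam hW hWb hT]
      exact ENNReal.mul_ne_top ENNReal.ofReal_ne_top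
        (ENNReal.mul_ne_top hWb.measure_lt_top.ne hk)
    -- The configuration is finite, so from some index on the approximation is exact at all its
    -- points simultaneously.
    · refine tendsto_nhds_of_eventually_eq ?_
      have : ∀ᶠ n in atTop, ∀ x ∈ T ω,
          F n (q n x) (cellCount (q n) ((T ω).erase x)) = L x ((T ω).erase x) :=
        (eventually_all_finset _).2 fun x hx => hL x (hTW ω hx) _
          ((Finset.coe_subset.2 (Finset.erase_subset _ _)).trans (hTW ω))
      exact this.mono fun n hn => Finset.sum_congr rfl hn
  have hr : Tendsto (fun n => ∫⁻ x in W, ∫⁻ ω, F n (q n x) (cellCount (q n) (T ω)) ∂P)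
      atTop (𝓝 (∫⁻ x in W, ∫⁻ ω, L x (T ω) ∂P)) := by
    refine tendsto_lintegral_of_dominated_convergence
      (fun _ => ∫⁻ ω, k (T ω).card ∂P) (fun n => ?_)
      (fun n => ae_of_all _ fun x => lintegral_mono fun ω => hFk n _ _) ?_
      (ae_restrict_of_forall_mem hW fun x hx => ?_)
    · exact (measurable_of_countable fun a => ∫⁻ ω, F n a (cellCount (q n) (T ω)) ∂P).comp (hq n)
    · rw [setLIntegral_const]
      exact ENNReal.mul_ne_top hk hWb.measure_lt_top.ne
    · refine tendsto_lintegral_of_dominated_convergence (fun ω => k (T ω).card) (fun n => ?_)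
        (fun n => ae_of_all _ fun ω => hFk n _ _) hk
        (ae_of_all _ fun ω => tendsto_nhds_of_eventually_eq (hL x hx _ (hTW ω)))
      exact (measurable_of_countable _).comp (hTm n)
  refine tendsto_nhds_unique hl ?_
  simp_rw [fun n => hX.lintegral_sum_cells hlam hW hWb hT (hq n) (F n)]
  exact ENNReal.Tendsto.const_mul hr (Or.inr ENNReal.ofReal_ne_top)

/-- The closure of W is compact, so finitely many points of a dense sequence are ε-dense in W and
the nearest one labels the cell. The Boolean flags make membership in A and B a function of the
cell. -/
lemma exists_fine_cells (hWb : Bornology.IsBounded W) {A B : Set (RSpace d)}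
    (hA : MeasurableSet A) (hB : MeasurableSet B) {ε : ℝ} (hε : 0 < ε) :
    ∃ (N : ℕ) (q : RSpace d → Fin N × Bool × Bool) (c : Fin N × Bool × Bool → RSpace d),
      Measurable q ∧ (∀ x ∈ W, dist (c (q x)) x ≤ ε) ∧ (∀ x, (q x).2.1 = true ↔ x ∈ A) ∧
        ∀ x, (q x).2.2 = true ↔ x ∈ B := by
  classical
  let e : ℕ → RSpace d := TopologicalSpace.denseSeq (RSpace d)
  have hcov : closure W ⊆ ⋃ k, Metric.ball (e k) ε := fun x _ => by
    obtain ⟨k, hk⟩ := (TopologicalSpace.denseRange_denseSeq (RSpace d)).exists_dist_lt x hε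
    exact mem_iUnion.2 ⟨k, hk⟩
  obtain ⟨t, ht⟩ := hWb.isCompact_closure.elim_finite_subcover _ (fun _ => Metric.isOpen_ball) hcov
  let N := t.sup id
  refine ⟨N + 1, fun x => (⟨SimpleFunc.nearestPtInd e N x,
    Nat.lt_succ_of_le (SimpleFunc.nearestPtInd_le e N x)⟩, decide (x ∈ A), decide (x ∈ B)),
    fun a => e a.1, ?_, fun x hx => ?_, fun x => by simp, fun x => by simp⟩
  · refine Measurable.prodMk ?_ (Measurable.prodMk ?_ ?_)
    · refine measurable_to_countable' fun k => ?_
      have : (fun x => (⟨SimpleFunc.nearestPtInd e N x,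
          Nat.lt_succ_of_le (SimpleFunc.nearestPtInd_le e N x)⟩ : Fin (N + 1))) ⁻¹' {k} =
          SimpleFunc.nearestPtInd e N ⁻¹' {k.1} := by
        ext x; simp [Fin.ext_iff]
      rw [this]
      exact (SimpleFunc.nearestPtInd e N).measurableSet_fiber _
    · exact measurable_to_bool (by simpa [preimage] using hA)
    · exact measurable_to_bool (by simpa [preimage] using hB)
  · obtain ⟨k, hk, hxk⟩ := mem_iUnion₂.1 (ht (subset_closure hx))
    have h := SimpleFunc.edist_nearestPt_le e x (Finset.le_sup (f := id) hk : k ≤ N)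
    rw [edist_dist, edist_dist, ENNReal.ofReal_le_ofReal_iff dist_nonneg] at h
    rw [Metric.mem_ball'] at hxk
    exact h.trans hxk.le

/-- A cell approximation of the relation `dist x y ≤ r`. -/
lemma exists_cells_sequence (hWb : Bornology.IsBounded W) {A B : Set (RSpace d)}
    (hA : MeasurableSet A) (hB : MeasurableSet B) (r : ℝ) :
    ∃ (N : ℕ → ℕ) (q : ∀ n, RSpace d → Fin (N n) × Bool × Bool)
      (R : ∀ n, Fin (N n) × Bool × Bool → Fin (N n) × Bool × Bool → Prop),
      (∀ n, Measurable (q n)) ∧ (∀ n x, (q n x).2.1 = true ↔ x ∈ A) ∧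
      (∀ n x, (q n x).2.2 = true ↔ x ∈ B) ∧
      ∀ x ∈ W, ∀ y ∈ W, ∀ᶠ n in atTop, (R n (q n x) (q n y) ↔ dist y x ≤ r) := by
  choose N q c hq hc hqA hqB using fun n : ℕ =>
    exists_fine_cells hWb hA hB (ε := 1 / ((n : ℝ) + 1)) (by positivity)
  -- Each centre is off by at most ε = 1/(n+1), so this test accepts every pair at distance at most
  -- r, and any pair it accepts is at distance at most r + 4ε.
  refine ⟨N, q, fun n a b => dist (c n b) (c n a) ≤ r + 2 * (1 / ((n : ℝ) + 1)), hq, hqA, hqB,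
    fun x hx y hy => ?_⟩
  have hlim : Tendsto (fun n : ℕ => r + 4 * (1 / ((n : ℝ) + 1))) atTop (𝓝 r) := by
    simpa using (tendsto_one_div_add_atTop_nhds_zero_nat (𝕜 := ℝ)).const_mul 4 |>.const_add r
  by_cases h : dist y x ≤ r
  · refine Eventually.of_forall fun n => iff_of_true ?_ h
    have h1 := hc n x hx
    have h2 := hc n y hy
    rw [dist_comm] at h1
    linarith [dist_triangle4 (c n (q n y)) y x (c n (q n x))]
  · filter_upwards [hlim.eventually (gt_mem_nhds (not_le.1 h))] with n hn
    refine iff_of_false (fun h' => ?_) h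
    have h1 := hc n x hx
    have h2 := hc n y hy
    rw [dist_comm] at h2
    linarith [dist_triangle4 y (c n (q n y)) (c n (q n x)) x]

open scoped Classical in
/-- The number of points of `S` within distance `r` of `x`. -/
noncomputable def ballCount (r : ℝ) (x : RSpace d) (S : Finset (RSpace d)) : ℕ :=
  (S.filter fun z => dist z x ≤ r).card

open scoped Classical in
lemma eventually_sum_cellCount_eq_ballCount {N : ℕ → ℕ}
    {q : ∀ n, RSpace d → Fin (N n) × Bool × Bool}
    {R : ∀ n, Fin (N n) × Bool × Bool → Fin (N n) × Bool × Bool → Prop} {r : ℝ}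
    (hR : ∀ x ∈ W, ∀ y ∈ W, ∀ᶠ n in atTop, (R n (q n x) (q n y) ↔ dist y x ≤ r))
    {x : RSpace d} (hx : x ∈ W) {S : Finset (RSpace d)} (hS : (S : Set (RSpace d)) ⊆ W) :
    ∀ᶠ n in atTop, ∑ a with R n (q n x) a, cellCount (q n) S a = ballCount r x S := by
  filter_upwards [(eventually_all_finset S).2 fun y hy => hR x hx y (hS hy)] with n hn
  rw [← card_filter_comp_eq_sum_cellCount (q n) S fun a => R n (q n x) a, ballCount,
    Finset.filter_congr hn]

open scoped Classical in
/-- The one-point Mecke formula for a function of the location and of the ball count. -/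
theorem IsPoissonProcess.lintegral_sum_ballCount [IsProbabilityMeasure P]
    (hX : IsPoissonProcess P lam X) (hlam : 0 ≤ lam)
    (hW : MeasurableSet W) (hWb : Bornology.IsBounded W)
    (hT : ∀ ω, (T ω : Set (RSpace d)) = X ω ∩ W) {A : Set (RSpace d)} (hA : MeasurableSet A)
    (r : ℝ) {φ : ℕ → ℝ≥0∞} (hφ : ∀ n, φ n ≤ 1) :
    ∫⁻ ω, ∑ x ∈ T ω, (if x ∈ A then φ (ballCount r x ((T ω).erase x)) else 0) ∂P =
      ENNReal.ofReal lam * ∫⁻ x in W, ∫⁻ ω, (if x ∈ A then φ (ballCount r x (T ω)) else 0) ∂P := by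
  obtain ⟨N, q, R, hq, hqA, -, hR⟩ := exists_cells_sequence hWb hA hA r
  refine hX.lintegral_sum_of_eventually_eq hlam hW hWb hT (k := fun _ => 1) (by simp) hq
    (F := fun n a m => if a.2.1 = true then φ (∑ c with R n a c, m c) else 0)
    (fun n a m => ?_) (L := fun x S => if x ∈ A then φ (ballCount r x S) else 0)
    fun x hx S hS => ?_
  · split_ifs
    · exact hφ _
    · exact zero_le_one
  · filter_upwards [eventually_sum_cellCount_eq_ballCount hR hx hS] with n hn
    simp only [hqA, hn]

open scoped Classical in
/-- The two-point Mecke formula for a function of the locations and of the two ball counts. -/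
theorem IsPoissonProcess.lintegral_sum_sum_ballCount [IsProbabilityMeasure P]
    (hX : IsPoissonProcess P lam X) (hlam : 0 ≤ lam)
    (hW : MeasurableSet W) (hWb : Bornology.IsBounded W)
    (hT : ∀ ω, (T ω : Set (RSpace d)) = X ω ∩ W) {A B : Set (RSpace d)} (hA : MeasurableSet A)
    (hB : MeasurableSet B) (r : ℝ) {Φ : ℕ → ℕ → ℝ≥0∞} (hΦ : ∀ m n, Φ m n ≤ 1) :
    ∫⁻ ω, ∑ x ∈ T ω, ∑ y ∈ (T ω).erase x, (if x ∈ A ∧ y ∈ B then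
        Φ ((if dist y x ≤ r then 1 else 0) + ballCount r x (((T ω).erase x).erase y))
          ((if dist y x ≤ r then 1 else 0) + ballCount r y (((T ω).erase x).erase y)) else 0) ∂P =
      ENNReal.ofReal lam * ∫⁻ x in W, ENNReal.ofReal lam * ∫⁻ y in W,
        ∫⁻ ω, (if x ∈ A ∧ y ∈ B then
          Φ ((if dist y x ≤ r then 1 else 0) + ballCount r x (T ω))
            ((if dist y x ≤ r then 1 else 0) + ballCount r y (T ω)) else 0) ∂P := by
  obtain ⟨N, q, R, hq, hqA, hqB, hR⟩ := exists_cells_sequence hWb hA hB r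
  let L : RSpace d → RSpace d → Finset (RSpace d) → ℝ≥0∞ := fun x y S =>
    if x ∈ A ∧ y ∈ B then
      Φ ((if dist y x ≤ r then 1 else 0) + ballCount r x S)
        ((if dist y x ≤ r then 1 else 0) + ballCount r y S) else 0
  let F : ∀ n, Fin (N n) × Bool × Bool → Fin (N n) × Bool × Bool →
      (Fin (N n) × Bool × Bool → ℕ) → ℝ≥0∞ := fun n a b m =>
    if a.2.1 = true ∧ b.2.2 = true then
      Φ ((if R n a b then 1 else 0) + ∑ c with R n a c, m c)
        ((if R n a b then 1 else 0) + ∑ c with R n b c, m c) else 0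
  have hF : ∀ n a b m, F n a b m ≤ 1 := fun n a b m => by
    dsimp only [F]
    split_ifs
    all_goals first | exact hΦ _ _ | exact zero_le_one
  have hFL : ∀ x ∈ W, ∀ y ∈ W, ∀ S : Finset (RSpace d), (S : Set (RSpace d)) ⊆ W →
      ∀ᶠ n in atTop, F n (q n x) (q n y) (cellCount (q n) S) = L x y S := by
    intro x hx y hy S hS
    filter_upwards [eventually_sum_cellCount_eq_ballCount hR hx hS,
      eventually_sum_cellCount_eq_ballCount hR hy hS, hR x hx y hy] with n h1 h2 h3
    simp only [F, L, hqA, hqB, h1, h2, h3]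
  have hcard : ∫⁻ ω, ((T ω).card : ℝ≥0∞) ∂P ≠ ∞ := by
    have h := hX.lintegral_sum_card hlam hW hWb hT fun _ => 1
    simp only [Finset.sum_const, nsmul_eq_mul, mul_one, lintegral_const, measure_univ] at h
    rw [h]
    exact ENNReal.mul_ne_top ENNReal.ofReal_ne_top hWb.measure_lt_top.ne
  -- The inner sum over y has at most as many terms as there are points, each at most 1; hence the
  -- majorant k n = n, integrable by `hcard`.
  have h1 := hX.lintegral_sum_of_eventually_eq hlam hW hWb hT (k := fun n => n) hcard hq
    (F := fun n a m => reducedSum (F n a) m) (L := fun x S => ∑ y ∈ S, L x y (S.erase y))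
    (fun n a m => by
      rw [reducedSum]
      push_cast
      exact Finset.sum_le_sum fun c _ => mul_le_of_le_one_right' (hF _ _ _ _))
    (fun x hx S hS => by
      simp_rw [← sum_eq_reducedSum]
      filter_upwards [(eventually_all_finset S).2 fun y hy => hFL x hx y (hS hy) (S.erase y)
        ((Finset.coe_subset.2 (Finset.erase_subset _ _)).trans hS)] with n hn
      exact Finset.sum_congr rfl hn)
  rw [h1]
  congr 1
  refine setLIntegral_congr_fun hW fun x hx => ?_
  -- With x fixed, its cell is a parameter and the one-point formula applies again, now to the sum
  -- over y.
  exact hX.lintegral_sum_of_eventually_eq hlam hW hWb hT (k := fun _ => 1) (by simp) hq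
    (F := fun n => F n (q n x)) (L := L x) (fun n a m => hF _ _ _ _) (hFL x hx)

end continuumMecke

/-! ### Integrating out the marks -/

section marking

open scoped ENNReal NNReal

lemma encard_eq_tsum_ite {α : Type*} (K : Set α) [DecidablePred (· ∈ K)] :
    (K.encard : ℝ≥0∞) = ∑' i, if i ∈ K then 1 else 0 := by
  rw [← ENNReal.tsum_set_one, tsum_subtype K fun _ => (1 : ℝ≥0∞)]
  exact tsum_congr fun i => by by_cases h : i ∈ K <;> simp [h]

/-- The extended cardinality is a countable sum of indicators; `ENat.toNat` sends infinity to 0, as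
`ncard` does. -/
lemma measurable_ncard_setOf {α : Type*} [MeasurableSpace α] {Q : ℕ → α → Prop}
    (hQ : ∀ j, MeasurableSet {a | Q j a}) : Measurable fun a => {j | Q j a}.ncard := by
  classical
  have h1 : Measurable fun a => ({j | Q j a}.encard : ℝ≥0∞) := by
    simp_rw [encard_eq_tsum_ite]
    exact Measurable.tsum fun j => Measurable.ite (hQ j) measurable_const measurable_const
  have h2 : Measurable fun a => {j | Q j a}.encard := by
    refine measurable_to_countable' fun k => ?_
    convert! h1 (measurableSet_singleton (k : ℝ≥0∞)) using 1
    ext a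
    simp
  exact (measurable_of_countable ENat.toNat).comp h2

lemma IndepFun.lintegral_eq {Ω α β : Type*} [MeasurableSpace Ω] [MeasurableSpace α]
    [MeasurableSpace β] {P : Measure Ω} [IsProbabilityMeasure P] {Y : Ω → α} {V : Ω → β}
    (h : IndepFun Y V P) (hY : Measurable Y) (hV : Measurable V) {f : α → β → ℝ≥0∞}
    (hf : Measurable (Function.uncurry f)) :
    ∫⁻ ω, f (Y ω) (V ω) ∂P = ∫⁻ ω, ∫⁻ v, f (Y ω) v ∂(P.map V) ∂P := by
  have := Measure.isProbabilityMeasure_map hV.aemeasurable (μ := P)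
  have h1 := (indepFun_iff_map_prod_eq_prod_map_map hY.aemeasurable hV.aemeasurable).1 h
  calc ∫⁻ ω, f (Y ω) (V ω) ∂P = ∫⁻ z, Function.uncurry f z ∂(P.map fun ω => (Y ω, V ω)) := by
        rw [lintegral_map hf (hY.prodMk hV)]; rfl
    _ = ∫⁻ y, ∫⁻ v, f y v ∂(P.map V) ∂(P.map Y) := by
        rw [h1, lintegral_prod _ hf.aemeasurable]; rfl
    _ = _ := lintegral_map (f := fun y => ∫⁻ v, f y v ∂(P.map V)) hf.lintegral_prod_right' hY

lemma volume_restrict_Ioo_Iic {a : ℝ} (ha : a ∈ Icc (0 : ℝ) 1) :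
    volume.restrict (Ioo (0 : ℝ) 1) (Iic a) = ENNReal.ofReal a := by
  rw [Measure.restrict_apply measurableSet_Iic]
  have : (Iic a ∩ Ioo 0 1 : Set ℝ) =ᵐ[volume] Ioc 0 a := by
    -- At a = 1 the two sets differ in the endpoint 1, so only almost everywhere equality holds.
    rcases ha.2.lt_or_eq with h | rfl
    · refine ae_of_all _ fun x => propext ?_
      exact ⟨fun hx => ⟨hx.2.1, hx.1⟩, fun hx => ⟨hx.2, hx.1, hx.2.trans_lt h⟩⟩
    · have : (Iic 1 ∩ Ioo 0 1 : Set ℝ) = Ioo 0 1 :=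
        inter_eq_right.2 fun x hx => hx.2.le
      rw [this]
      exact Ioo_ae_eq_Ioc
  rw [measure_congr this, Real.volume_Ioc, sub_zero]

variable {d : ℕ} {Ω : Type*} [MeasurableSpace Ω] {P : Measure Ω} [IsProbabilityMeasure P]
  {X : Ω → Set (RSpace d)} {κ : Ω → ℕ∞} {ξ : ℕ → Ω → RSpace d} {U : ℕ → Ω → ℝ}

/-- The enumerated point process as a random element. -/
abbrev enumeration (κ : Ω → ℕ∞) (ξ : ℕ → Ω → RSpace d) (ω : Ω) : ℕ∞ × (ℕ → RSpace d) :=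
  (κ ω, fun i => ξ i ω)

/-- The number of enumerated points other than the `i`-th one within distance `r` of it. -/
noncomputable def enumNeighbourCount (r : ℝ) (i : ℕ) (s : ℕ∞ × (ℕ → RSpace d)) : ℕ :=
  {j : ℕ | (j : ℕ∞) < s.1 ∧ s.2 j ≠ s.2 i ∧ dist (s.2 j) (s.2 i) ≤ r}.ncard

lemma measurableSet_lt_card (i : ℕ) :
    MeasurableSet {s : ℕ∞ × (ℕ → RSpace d) | (i : ℕ∞) < s.1} :=
  measurable_fst (MeasurableSet.of_discrete (s := {k : ℕ∞ | (i : ℕ∞) < k}))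

lemma measurable_enum_point (i : ℕ) :
    Measurable fun s : ℕ∞ × (ℕ → RSpace d) => s.2 i :=
  (measurable_pi_apply i).comp measurable_snd

lemma measurable_enumNeighbourCount (r : ℝ) (i : ℕ) :
    Measurable (enumNeighbourCount (d := d) r i) := by
  refine measurable_ncard_setOf fun j => ?_
  refine (measurableSet_lt_card j).inter (MeasurableSet.inter ?_ ?_)
  · exact (measurableSet_eq_fun (measurable_enum_point j) (measurable_enum_point i)).compl
  · exact measurableSet_le ((measurable_enum_point j).dist (measurable_enum_point i))
      measurable_const

lemma IsIndependentMarking.measurable_enumeration {P : Measure Ω}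
    (hM : IsIndependentMarking P X κ ξ U) :
    Measurable (enumeration κ ξ) :=
  hM.measurable_card.prodMk (measurable_pi_lambda _ hM.measurable_point)

open scoped Classical in
-- The threshold depends on the points alone, so Fubini replaces the retention event by the
-- probability that a uniform mark is at most a.
lemma IsIndependentMarking.lintegral_mark (hM : IsIndependentMarking P X κ ξ U) (i : ℕ)
    {G : ℕ∞ × (ℕ → RSpace d) → ℝ≥0∞} (hG : Measurable G) {a : ℕ∞ × (ℕ → RSpace d) → ℝ}
    (ha : Measurable a) (ha1 : ∀ s, a s ∈ Icc (0 : ℝ) 1) :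
    ∫⁻ ω, (if U i ω ≤ a (enumeration κ ξ ω) then G (enumeration κ ξ ω) else 0) ∂P =
      ∫⁻ ω, G (enumeration κ ξ ω) * ENNReal.ofReal (a (enumeration κ ξ ω)) ∂P := by
  have h : IndepFun (enumeration κ ξ) (U i) P :=
    hM.indep_points.comp measurable_id (measurable_pi_apply i)
  rw [IndepFun.lintegral_eq h hM.measurable_enumeration (hM.measurable_mark i)
    (f := fun s u => if u ≤ a s then G s else 0)]
  · refine lintegral_congr fun ω => ?_
    rw [hM.uniform i, ← volume_restrict_Ioo_Iic (ha1 (enumeration κ ξ ω)),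
      ← lintegral_indicator_const measurableSet_Iic]
    rfl
  · exact Measurable.ite (measurableSet_le measurable_snd (ha.comp measurable_fst))
      (hG.comp measurable_fst) measurable_const

open scoped Classical in
lemma IsIndependentMarking.lintegral_two_marks (hM : IsIndependentMarking P X κ ξ U) {i j : ℕ}
    (hij : i ≠ j) {G : ℕ∞ × (ℕ → RSpace d) → ℝ≥0∞} (hG : Measurable G)
    {a b : ℕ∞ × (ℕ → RSpace d) → ℝ} (ha : Measurable a) (ha1 : ∀ s, a s ∈ Icc (0 : ℝ) 1)
    (hb : Measurable b) (hb1 : ∀ s, b s ∈ Icc (0 : ℝ) 1) :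
    ∫⁻ ω, (if U i ω ≤ a (enumeration κ ξ ω) ∧ U j ω ≤ b (enumeration κ ξ ω)
        then G (enumeration κ ξ ω) else 0) ∂P =
      ∫⁻ ω, G (enumeration κ ξ ω) * (ENNReal.ofReal (a (enumeration κ ξ ω)) *
        ENNReal.ofReal (b (enumeration κ ξ ω))) ∂P := by
  have h : IndepFun (enumeration κ ξ) (fun ω => (U i ω, U j ω)) P :=
    hM.indep_points.comp measurable_id
      ((measurable_pi_apply i).prodMk (measurable_pi_apply j) :
        Measurable fun u : ℕ → ℝ => (u i, u j))
  have hlaw : P.map (fun ω => (U i ω, U j ω)) =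
      (volume.restrict (Ioo (0 : ℝ) 1)).prod (volume.restrict (Ioo (0 : ℝ) 1)) := by
    rw [(indepFun_iff_map_prod_eq_prod_map_map (hM.measurable_mark i).aemeasurable
      (hM.measurable_mark j).aemeasurable).1 (hM.indep_marks.indepFun hij), hM.uniform, hM.uniform]
  rw [IndepFun.lintegral_eq h hM.measurable_enumeration
    ((hM.measurable_mark i).prodMk (hM.measurable_mark j))
    (f := fun s u => if u.1 ≤ a s ∧ u.2 ≤ b s then G s else 0)]
  · refine lintegral_congr fun ω => ?_
    rw [hlaw, ← volume_restrict_Ioo_Iic (ha1 (enumeration κ ξ ω)),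
      ← volume_restrict_Ioo_Iic (hb1 (enumeration κ ξ ω)), ← Measure.prod_prod,
      ← lintegral_indicator_const (measurableSet_Iic.prod measurableSet_Iic)]
    exact lintegral_congr fun v => by simp only [indicator_apply, mem_prod, mem_Iic]
  · exact Measurable.ite (MeasurableSet.inter
      (measurableSet_le (measurable_fst.comp measurable_snd) (ha.comp measurable_fst))
      (measurableSet_le (measurable_snd.comp measurable_snd) (hb.comp measurable_fst)))
      (hG.comp measurable_fst) measurable_const

end marking

/-! ### From enumerated points to finite configurations -/

section enumeration

open scoped ENNReal NNReal

variable {d : ℕ} {W : Set (RSpace d)} {T : Finset (RSpace d)} {Y : Set (RSpace d)} {k : ℕ∞}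
  {z : ℕ → RSpace d}

open scoped Classical in
-- As g vanishes off W, only indices of points in the finite set T contribute, and distinctness
-- gives each such point exactly one index.
lemma tsum_enumeration (hY : Y = {x | ∃ i : ℕ, (i : ℕ∞) < k ∧ z i = x})
    (hz : ∀ i j : ℕ, (i : ℕ∞) < k → (j : ℕ∞) < k → z i = z j → i = j)
    (hT : (T : Set (RSpace d)) = Y ∩ W) {g : RSpace d → ℝ≥0∞} (hg : ∀ x ∉ W, g x = 0) :
    ∑' i : ℕ, (if (i : ℕ∞) < k then g (z i) else 0) = ∑ x ∈ T, g x := by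
  have hidx : ∀ x : T, ∃ i : ℕ, (i : ℕ∞) < k ∧ z i = x := fun x => by
    have : (x : RSpace d) ∈ Y ∩ W := hT ▸ x.2
    rw [hY] at this
    exact this.1
  choose idx hidx hzidx using hidx
  have hinj : Function.Injective idx := fun x y hxy => by
    rw [Subtype.ext_iff, ← hzidx x, ← hzidx y, hxy]
  rw [← Finset.tsum_subtype, ← hinj.tsum_eq]
  · exact tsum_congr fun x => by rw [if_pos (hidx x), hzidx]
  · intro i hi
    have hik : (i : ℕ∞) < k := by
      by_contra h; exact hi (by simp [h])
    have hgi : g (z i) ≠ 0 := fun h => hi (by simp [h])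
    have hiT : z i ∈ T := by
      rw [← Finset.mem_coe, hT, hY]
      exact ⟨⟨i, hik, rfl⟩, by_contra fun h => hgi (hg _ h)⟩
    exact ⟨⟨z i, hiT⟩, hz _ _ (hidx _) hik (hzidx _)⟩

open scoped Classical in
lemma tsum_tsum_enumeration (hY : Y = {x | ∃ i : ℕ, (i : ℕ∞) < k ∧ z i = x})
    (hz : ∀ i j : ℕ, (i : ℕ∞) < k → (j : ℕ∞) < k → z i = z j → i = j)
    (hT : (T : Set (RSpace d)) = Y ∩ W) {g : RSpace d → RSpace d → ℝ≥0∞}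
    (hg : ∀ x ∉ W, ∀ y, g x y = 0) (hg' : ∀ x, ∀ y ∉ W, g x y = 0) :
    ∑' i : ℕ, ∑' j : ℕ, (if (i : ℕ∞) < k ∧ (j : ℕ∞) < k ∧ i ≠ j then g (z i) (z j) else 0) =
      ∑ x ∈ T, ∑ y ∈ T.erase x, g x y := by
  rw [← tsum_enumeration hY hz hT (g := fun x => ∑ y ∈ T.erase x, g x y)
    fun x hx => Finset.sum_eq_zero fun y _ => hg x hx y]
  refine tsum_congr fun i => ?_
  by_cases hi : (i : ℕ∞) < k
  · have herase : T.erase (z i) = T.filter fun y => y ≠ z i := by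
      ext y; simp [and_comm]
    rw [if_pos hi, herase, Finset.sum_filter, ← tsum_enumeration hY hz hT
      (g := fun y => if y ≠ z i then g (z i) y else 0) fun y hy => by simp [hg' _ y hy]]
    refine tsum_congr fun j => ?_
    rw [← ite_and]
    refine if_congr ⟨fun h => ⟨h.2.1, fun h' => h.2.2 (hz _ _ hi h.2.1 h'.symm)⟩,
      fun h => ⟨hi, h.1, fun h' => h.2 (by rw [h'])⟩⟩ rfl rfl
  · simp [hi]

/-- Isolates the contribution of the partner point, leaving the count over the configuration that
enters the two-point Mecke formula. -/
lemma ballCount_eq_add (r : ℝ) (x : RSpace d) {y : RSpace d} (hy : y ∈ T) [DecidableEq (RSpace d)]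
    [Decidable (dist y x ≤ r)] :
    ballCount r x T = (if dist y x ≤ r then 1 else 0) + ballCount r x (T.erase y) := by
  classical
  rw [ballCount, ballCount, Finset.filter_erase]
  split_ifs with h
  · rw [add_comm]
    have hy' : y ∈ T.filter fun w => dist w x ≤ r := Finset.mem_filter.2 ⟨hy, h⟩
    convert! (Finset.card_erase_add_one hy').symm
  · rw [zero_add, Finset.erase_eq_of_notMem]
    simp [h]

lemma neighbourCount_eq_ballCount {r : ℝ} {x : RSpace d} (hT : (T : Set (RSpace d)) = Y ∩ W)
    (hx : Metric.closedBall x r ⊆ W) [DecidableEq (RSpace d)] :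
    neighbourCount r x Y = ballCount r x (T.erase x) := by
  classical
  rw [neighbourCount, ballCount, ← Set.ncard_coe_finset]
  congr 1
  ext y
  have : y ∈ T ↔ y ∈ Y ∧ y ∈ W := by rw [← Finset.mem_coe, hT]; rfl
  simp only [Finset.coe_filter, Finset.mem_erase, this, mem_sdiff, mem_inter_iff,
    Metric.mem_closedBall, mem_singleton_iff, mem_ofPred_eq]
  exact ⟨fun h => ⟨⟨h.2, h.1.1, hx h.1.2⟩, h.1.2⟩, fun h => ⟨⟨h.1.2.1, h.2⟩, h.1.1⟩⟩

lemma neighbourCount_eq_enumNeighbourCount (hY : Y = {x | ∃ i : ℕ, (i : ℕ∞) < k ∧ z i = x})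
    (hz : ∀ i j : ℕ, (i : ℕ∞) < k → (j : ℕ∞) < k → z i = z j → i = j) (r : ℝ) (i : ℕ) :
    neighbourCount r (z i) Y = enumNeighbourCount r i (k, z) := by
  rw [neighbourCount, enumNeighbourCount, ← Set.InjOn.ncard_image (f := z)
    fun j hj l hl h => hz j l hj.1 hl.1 h]
  congr 1
  ext y
  rw [hY]
  constructor
  · rintro ⟨⟨⟨j, hj, rfl⟩, hd⟩, hne⟩
    exact ⟨j, ⟨hj, hne, hd⟩, rfl⟩
  · rintro ⟨j, ⟨hj, hne, hd⟩, rfl⟩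
    exact ⟨⟨⟨j, hj, rfl⟩, hd⟩, hne⟩

end enumeration

/-! ### Moment measures of the thinned process without marks -/

section thinnedMoments

open scoped ENNReal NNReal

variable {d : ℕ} {Ω : Type*} [MeasurableSpace Ω] {P : Measure Ω} [IsProbabilityMeasure P]
  {X : Ω → Set (RSpace d)} {κ : Ω → ℕ∞} {ξ : ℕ → Ω → RSpace d} {U : ℕ → Ω → ℝ}
  {W : Set (RSpace d)} {T : Ω → Finset (RSpace d)} {p : ℕ → ℝ} {r : ℝ}

lemma measurable_comp_enumNeighbourCount (p : ℕ → ℝ) (r : ℝ) (i : ℕ) :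
    Measurable fun s : ℕ∞ × (ℕ → RSpace d) => p (enumNeighbourCount r i s) :=
  (measurable_of_countable p).comp (measurable_enumNeighbourCount r i)

open scoped Classical in
/-- The marks can be integrated out of the intensity measure of the thinned process. -/
theorem IsIndependentMarking.lintegral_encard_thinning (hM : IsIndependentMarking P X κ ξ U)
    (hp : ∀ n, p n ∈ Icc (0 : ℝ) 1) (hT : ∀ ω, (T ω : Set (RSpace d)) = X ω ∩ W)
    {B : Set (RSpace d)} (hB : MeasurableSet B) (hBW : B ⊆ W)
    (hBr : ∀ x ∈ B, Metric.closedBall x r ⊆ W) :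
    ∫⁻ ω, ((thinning p r X κ ξ U ω ∩ B).encard : ℝ≥0∞) ∂P =
      ∫⁻ ω, ∑ x ∈ T ω,
        (if x ∈ B then ENNReal.ofReal (p (ballCount r x ((T ω).erase x))) else 0) ∂P := by
  let G : ℕ → ℕ∞ × (ℕ → RSpace d) → ℝ≥0∞ := fun i s =>
    if (i : ℕ∞) < s.1 ∧ s.2 i ∈ B then 1 else 0
  let a : ℕ → ℕ∞ × (ℕ → RSpace d) → ℝ := fun i s => p (enumNeighbourCount r i s)
  have hG : ∀ i, Measurable (G i) := fun i =>
    Measurable.ite ((measurableSet_lt_card i).inter (measurable_enum_point i hB))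
      measurable_const measurable_const
  have ha : ∀ i, Measurable (a i) := fun i => measurable_comp_enumNeighbourCount p r i
  have hY := hM.measurable_enumeration
  calc _ = ∫⁻ ω, ∑' i, (if U i ω ≤ a i (enumeration κ ξ ω) then G i (enumeration κ ξ ω) else 0)
        ∂P := by
        refine lintegral_congr_ae ?_
        filter_upwards [hM.enumerates, hM.distinct] with ω h1 h2
        have hset : thinning p r X κ ξ U ω ∩ B = (fun i => ξ i ω) '' {i | (i : ℕ∞) < κ ω ∧
            ξ i ω ∈ B ∧ U i ω ≤ a i (enumeration κ ξ ω)} := by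
          ext x
          constructor
          · rintro ⟨⟨i, hi, rfl, hU⟩, hx⟩
            refine ⟨i, ⟨hi, hx, ?_⟩, rfl⟩
            rwa [neighbourCount_eq_enumNeighbourCount h1 h2] at hU
          · rintro ⟨i, ⟨hi, hx, hU⟩, rfl⟩
            refine ⟨⟨i, hi, rfl, ?_⟩, hx⟩
            rwa [neighbourCount_eq_enumNeighbourCount h1 h2]
        rw [hset, InjOn.encard_image fun i hi j hj h => h2 i j hi.1 hj.1 h, encard_eq_tsum_ite]
        refine tsum_congr fun i => ?_
        simp only [G, mem_ofPred_eq, ← ite_and]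
        exact if_congr (by tauto) rfl rfl
    _ = ∑' i, ∫⁻ ω, G i (enumeration κ ξ ω) * ENNReal.ofReal (a i (enumeration κ ξ ω)) ∂P := by
        have hm : ∀ i, Measurable fun ω =>
            if U i ω ≤ a i (enumeration κ ξ ω) then G i (enumeration κ ξ ω) else 0 := fun i =>
          Measurable.ite (measurableSet_le (hM.measurable_mark i) ((ha i).comp hY))
            ((hG i).comp hY) measurable_const
        rw [lintegral_tsum fun i => (hm i).aemeasurable]
        exact tsum_congr fun i => hM.lintegral_mark i (hG i) (ha i) fun s => hp _
    _ = ∫⁻ ω, ∑' i, G i (enumeration κ ξ ω) * ENNReal.ofReal (a i (enumeration κ ξ ω)) ∂P :=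
        (lintegral_tsum fun i =>
          (((hG i).mul (ha i).ennreal_ofReal).comp hY).aemeasurable).symm
    _ = _ := by
        refine lintegral_congr_ae ?_
        filter_upwards [hM.enumerates, hM.distinct] with ω h1 h2
        rw [← tsum_enumeration h1 h2 (hT ω) (g := fun x =>
          if x ∈ B then ENNReal.ofReal (p (ballCount r x ((T ω).erase x))) else 0)
          fun x hx => if_neg fun h => hx (hBW h)]
        refine tsum_congr fun i => ?_
        simp only [G, ← ite_and]
        split_ifs with h
        · rw [one_mul, ← neighbourCount_eq_ballCount (hT ω) (hBr _ h.2),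
            neighbourCount_eq_enumNeighbourCount h1 h2]
        · rw [zero_mul]

open scoped Classical in
/-- The indicator that the points with indices `i` and `j` exist and lie in `A` and `B`. -/
noncomputable def pairIndicator (A B : Set (RSpace d)) (q : ℕ × ℕ) (s : ℕ∞ × (ℕ → RSpace d)) :
    ℝ≥0∞ :=
  if ((q.1 : ℕ∞) < s.1 ∧ s.2 q.1 ∈ A) ∧ ((q.2 : ℕ∞) < s.1 ∧ s.2 q.2 ∈ B) then 1 else 0

lemma measurable_pairIndicator {A B : Set (RSpace d)} (hA : MeasurableSet A)
    (hB : MeasurableSet B) (q : ℕ × ℕ) : Measurable (pairIndicator A B q) :=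
  Measurable.ite (((measurableSet_lt_card q.1).inter (measurable_enum_point q.1 hA)).inter
    ((measurableSet_lt_card q.2).inter (measurable_enum_point q.2 hB)))
    measurable_const measurable_const

open scoped Classical in
lemma encard_thinning_pairs_eq_tsum {Ω : Type*} {X : Ω → Set (RSpace d)} {κ : Ω → ℕ∞}
    {ξ : ℕ → Ω → RSpace d} {U : ℕ → Ω → ℝ} {ω : Ω} (A B : Set (RSpace d))
    (h1 : X ω = {x | ∃ i : ℕ, (i : ℕ∞) < κ ω ∧ ξ i ω = x})
    (h2 : ∀ i j : ℕ, (i : ℕ∞) < κ ω → (j : ℕ∞) < κ ω → ξ i ω = ξ j ω → i = j) :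
    ({q : RSpace d × RSpace d | q.1 ∈ thinning p r X κ ξ U ω ∩ A ∧
        q.2 ∈ thinning p r X κ ξ U ω ∩ B ∧ q.1 ≠ q.2}.encard : ℝ≥0∞) =
      ∑' q : ℕ × ℕ, (if q.1 ≠ q.2 then
        (if U q.1 ω ≤ p (enumNeighbourCount r q.1 (enumeration κ ξ ω)) ∧
          U q.2 ω ≤ p (enumNeighbourCount r q.2 (enumeration κ ξ ω))
        then pairIndicator A B q (enumeration κ ξ ω) else 0) else 0) := by
  have hset : {q : RSpace d × RSpace d | q.1 ∈ thinning p r X κ ξ U ω ∩ A ∧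
      q.2 ∈ thinning p r X κ ξ U ω ∩ B ∧ q.1 ≠ q.2} =
      (fun q : ℕ × ℕ => (ξ q.1 ω, ξ q.2 ω)) '' {q | ((q.1 : ℕ∞) < κ ω ∧ (q.2 : ℕ∞) < κ ω) ∧
        q.1 ≠ q.2 ∧ (U q.1 ω ≤ p (enumNeighbourCount r q.1 (enumeration κ ξ ω)) ∧
          U q.2 ω ≤ p (enumNeighbourCount r q.2 (enumeration κ ξ ω))) ∧
        ξ q.1 ω ∈ A ∧ ξ q.2 ω ∈ B} := by
    ext ⟨x, y⟩
    constructor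
    · rintro ⟨⟨⟨i, hi, rfl, hU⟩, hx⟩, ⟨⟨j, hj, rfl, hV⟩, hy⟩, hne⟩
      rw [neighbourCount_eq_enumNeighbourCount h1 h2] at hU hV
      exact ⟨(i, j), ⟨⟨hi, hj⟩, fun h => hne (congrArg (fun i => ξ i ω) h), ⟨hU, hV⟩, hx, hy⟩, rfl⟩
    · rintro ⟨⟨i, j⟩, ⟨⟨hi, hj⟩, hne, ⟨hU, hV⟩, hx, hy⟩, h⟩
      simp only [Prod.mk.injEq] at h
      obtain ⟨rfl, rfl⟩ := h
      refine ⟨⟨⟨i, hi, rfl, ?_⟩, hx⟩, ⟨⟨j, hj, rfl, ?_⟩, hy⟩, fun h => hne (h2 i j hi hj h)⟩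
      · rwa [neighbourCount_eq_enumNeighbourCount h1 h2]
      · rwa [neighbourCount_eq_enumNeighbourCount h1 h2]
  rw [hset, InjOn.encard_image fun q hq q' hq' h => Prod.ext
    (h2 _ _ hq.1.1 hq'.1.1 (congrArg Prod.fst h))
    (h2 _ _ hq.1.2 hq'.1.2 (congrArg Prod.snd h)), encard_eq_tsum_ite]
  refine tsum_congr fun q => ?_
  simp only [pairIndicator, mem_ofPred_eq, ← ite_and]
  exact if_congr (by tauto) rfl rfl

open scoped Classical in
-- By symmetry of the distance, the two points of a pair are neighbours of each other or neither is;
-- hence the same indicator in both arguments of Φ. The window contains the balls around A and B, so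
-- no neighbour is lost.
lemma tsum_pairIndicator_eq_sum {Ω : Type*} {X : Ω → Set (RSpace d)} {κ : Ω → ℕ∞}
    {ξ : ℕ → Ω → RSpace d} {T : Ω → Finset (RSpace d)} {ω : Ω} {A B : Set (RSpace d)}
    (h1 : X ω = {x | ∃ i : ℕ, (i : ℕ∞) < κ ω ∧ ξ i ω = x})
    (h2 : ∀ i j : ℕ, (i : ℕ∞) < κ ω → (j : ℕ∞) < κ ω → ξ i ω = ξ j ω → i = j)
    (hT : (T ω : Set (RSpace d)) = X ω ∩ W) (hAW : A ⊆ W)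
    (hAr : ∀ x ∈ A, Metric.closedBall x r ⊆ W) (hBW : B ⊆ W)
    (hBr : ∀ x ∈ B, Metric.closedBall x r ⊆ W) (Φ : ℕ → ℕ → ℝ≥0∞) :
    ∑' q : ℕ × ℕ, (if q.1 ≠ q.2 then pairIndicator A B q (enumeration κ ξ ω) *
        Φ (enumNeighbourCount r q.1 (enumeration κ ξ ω))
          (enumNeighbourCount r q.2 (enumeration κ ξ ω)) else 0) =
      ∑ x ∈ T ω, ∑ y ∈ (T ω).erase x, (if x ∈ A ∧ y ∈ B then
        Φ ((if dist y x ≤ r then 1 else 0) + ballCount r x (((T ω).erase x).erase y))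
          ((if dist y x ≤ r then 1 else 0) + ballCount r y (((T ω).erase x).erase y)) else 0) := by
  rw [← tsum_tsum_enumeration h1 h2 hT (g := fun x y => if x ∈ A ∧ y ∈ B then
      Φ ((if dist y x ≤ r then 1 else 0) + ballCount r x (((T ω).erase x).erase y))
        ((if dist y x ≤ r then 1 else 0) + ballCount r y (((T ω).erase x).erase y)) else 0)
    (fun x hx y => if_neg fun h => hx (hAW h.1)) (fun x y hy => if_neg fun h => hy (hBW h.2)),
    ENNReal.tsum_prod']
  refine tsum_congr fun i => tsum_congr fun j => ?_
  by_cases h : ((i : ℕ∞) < κ ω ∧ (j : ℕ∞) < κ ω ∧ i ≠ j) ∧ ξ i ω ∈ A ∧ ξ j ω ∈ B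
  · obtain ⟨⟨hi, hj, hij⟩, hxA, hyB⟩ := h
    have hxT : ξ i ω ∈ T ω := by
      rw [← Finset.mem_coe, hT, h1]; exact ⟨⟨i, hi, rfl⟩, hAW hxA⟩
    have hyT : ξ j ω ∈ T ω := by
      rw [← Finset.mem_coe, hT, h1]; exact ⟨⟨j, hj, rfl⟩, hBW hyB⟩
    have hne : ξ i ω ≠ ξ j ω := fun h => hij (h2 i j hi hj h)
    have e1 : enumNeighbourCount r i (enumeration κ ξ ω) =
        (if dist (ξ j ω) (ξ i ω) ≤ r then 1 else 0)
          + ballCount r (ξ i ω) (((T ω).erase (ξ i ω)).erase (ξ j ω)) := by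
      rw [← neighbourCount_eq_enumNeighbourCount h1 h2,
        neighbourCount_eq_ballCount hT (hAr _ hxA),
        ballCount_eq_add r _ (Finset.mem_erase.2 ⟨hne.symm, hyT⟩)]
    have e2 : enumNeighbourCount r j (enumeration κ ξ ω) =
        (if dist (ξ j ω) (ξ i ω) ≤ r then 1 else 0)
          + ballCount r (ξ j ω) (((T ω).erase (ξ i ω)).erase (ξ j ω)) := by
      rw [← neighbourCount_eq_enumNeighbourCount h1 h2,
        neighbourCount_eq_ballCount hT (hBr _ hyB),
        ballCount_eq_add r _ (Finset.mem_erase.2 ⟨hne, hxT⟩), Finset.erase_right_comm,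
        dist_comm (ξ j ω)]
    have hG : pairIndicator A B (i, j) (enumeration κ ξ ω) = 1 :=
      if_pos ⟨⟨hi, hxA⟩, hj, hyB⟩
    rw [if_pos (show (i, j).1 ≠ (i, j).2 from hij), hG, one_mul, e1, e2,
      if_pos (show (i : ℕ∞) < κ ω ∧ (j : ℕ∞) < κ ω ∧ i ≠ j from ⟨hi, hj, hij⟩),
      if_pos (show ξ i ω ∈ A ∧ ξ j ω ∈ B from ⟨hxA, hyB⟩)]
  · rw [← ite_and, if_neg h]
    by_cases hij : i ≠ j
    · have : pairIndicator A B (i, j) (enumeration κ ξ ω) = 0 := if_neg fun h' =>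
        h ⟨⟨h'.1.1, h'.2.1, hij⟩, h'.1.2, h'.2.2⟩
      rw [this, zero_mul, ite_self]
    · exact if_neg hij

open scoped Classical in
/-- The marks can be integrated out of the second factorial moment measure of the thinned
process. -/
theorem IsIndependentMarking.lintegral_encard_thinning_pairs
    (hM : IsIndependentMarking P X κ ξ U)
    (hp : ∀ n, p n ∈ Icc (0 : ℝ) 1) (hT : ∀ ω, (T ω : Set (RSpace d)) = X ω ∩ W)
    {A B : Set (RSpace d)} (hA : MeasurableSet A) (hAW : A ⊆ W)
    (hAr : ∀ x ∈ A, Metric.closedBall x r ⊆ W) (hB : MeasurableSet B) (hBW : B ⊆ W)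
    (hBr : ∀ x ∈ B, Metric.closedBall x r ⊆ W) :
    ∫⁻ ω, ({q : RSpace d × RSpace d | q.1 ∈ thinning p r X κ ξ U ω ∩ A ∧
        q.2 ∈ thinning p r X κ ξ U ω ∩ B ∧ q.1 ≠ q.2}.encard : ℝ≥0∞) ∂P =
      ∫⁻ ω, ∑ x ∈ T ω, ∑ y ∈ (T ω).erase x, (if x ∈ A ∧ y ∈ B then
        ENNReal.ofReal (p ((if dist y x ≤ r then 1 else 0)
            + ballCount r x (((T ω).erase x).erase y))) *
          ENNReal.ofReal (p ((if dist y x ≤ r then 1 else 0)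
            + ballCount r y (((T ω).erase x).erase y))) else 0) ∂P := by
  let a : ℕ → ℕ∞ × (ℕ → RSpace d) → ℝ := fun i s => p (enumNeighbourCount r i s)
  have ha : ∀ i, Measurable (a i) := fun i => measurable_comp_enumNeighbourCount p r i
  have hY := hM.measurable_enumeration
  have hG := measurable_pairIndicator hA hB
  have hm : ∀ q : ℕ × ℕ, Measurable fun ω => if q.1 ≠ q.2 then
      (if U q.1 ω ≤ a q.1 (enumeration κ ξ ω) ∧ U q.2 ω ≤ a q.2 (enumeration κ ξ ω)
        then pairIndicator A B q (enumeration κ ξ ω) else 0) else 0 := fun q =>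
    Measurable.ite (MeasurableSet.const _) (Measurable.ite (MeasurableSet.inter
      (measurableSet_le (hM.measurable_mark q.1) ((ha q.1).comp hY))
      (measurableSet_le (hM.measurable_mark q.2) ((ha q.2).comp hY)))
      ((hG q).comp hY) measurable_const) measurable_const
  have hm' : ∀ q : ℕ × ℕ, Measurable fun ω => if q.1 ≠ q.2 then
      pairIndicator A B q (enumeration κ ξ ω) * (ENNReal.ofReal (a q.1 (enumeration κ ξ ω)) *
        ENNReal.ofReal (a q.2 (enumeration κ ξ ω))) else 0 := fun q =>
    Measurable.ite (MeasurableSet.const _)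
      (((hG q).comp hY).mul (((ha q.1).comp hY).ennreal_ofReal.mul
        ((ha q.2).comp hY).ennreal_ofReal)) measurable_const
  calc _ = ∫⁻ ω, ∑' q : ℕ × ℕ, (if q.1 ≠ q.2 then
          (if U q.1 ω ≤ a q.1 (enumeration κ ξ ω) ∧ U q.2 ω ≤ a q.2 (enumeration κ ξ ω)
          then pairIndicator A B q (enumeration κ ξ ω) else 0) else 0) ∂P := by
        refine lintegral_congr_ae ?_
        filter_upwards [hM.enumerates, hM.distinct] with ω h1 h2
        exact encard_thinning_pairs_eq_tsum A B h1 h2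
    _ = ∑' q : ℕ × ℕ, ∫⁻ ω, (if q.1 ≠ q.2 then pairIndicator A B q (enumeration κ ξ ω) *
          (ENNReal.ofReal (a q.1 (enumeration κ ξ ω)) *
            ENNReal.ofReal (a q.2 (enumeration κ ξ ω))) else 0) ∂P := by
        rw [lintegral_tsum fun q => (hm q).aemeasurable]
        refine tsum_congr fun q => ?_
        by_cases hq : q.1 ≠ q.2
        · simp only [if_pos hq]
          exact hM.lintegral_two_marks hq (hG _) (ha _) (fun s => hp _) (ha _) fun s => hp _
        · simp only [if_neg hq]
    _ = ∫⁻ ω, ∑' q : ℕ × ℕ, (if q.1 ≠ q.2 then pairIndicator A B q (enumeration κ ξ ω) *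
          (ENNReal.ofReal (a q.1 (enumeration κ ξ ω)) *
            ENNReal.ofReal (a q.2 (enumeration κ ξ ω))) else 0) ∂P :=
        (lintegral_tsum fun q => (hm' q).aemeasurable).symm
    _ = _ := by
        refine lintegral_congr_ae ?_
        filter_upwards [hM.enumerates, hM.distinct] with ω h1 h2
        exact tsum_pairIndicator_eq_sum h1 h2 (hT ω) hAW hAr hBW hBr
          fun m n => ENNReal.ofReal (p m) * ENNReal.ofReal (p n)

end thinnedMoments

/-! ### The overlap of two balls -/

section overlap

open scoped ENNReal NNReal Topology Pointwise
open Filter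

variable {d : ℕ}

lemma unitBallVolume_pos (d : ℕ) : 0 < unitBallVolume d :=
  ENNReal.toReal_pos (Metric.measure_closedBall_pos volume _ one_pos).ne'
    measure_closedBall_lt_top.ne

lemma volume_real_closedBall (x : RSpace d) {r : ℝ} (hr : 0 ≤ r) :
    volume.real (Metric.closedBall x r) = unitBallVolume d * r ^ d := by
  rw [Measure.addHaar_real_closedBall' volume x hr, finrank_euclideanSpace_fin, mul_comm]
  rfl

variable [NeZero d]

lemma overlapCoeff_mem_Icc (t : ℝ) : overlapCoeff d t ∈ Icc (0 : ℝ) 1 := by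
  refine ⟨div_nonneg measureReal_nonneg (unitBallVolume_pos d).le, ?_⟩
  rw [overlapCoeff, div_le_one (unitBallVolume_pos d)]
  exact measureReal_mono inter_subset_left measure_closedBall_lt_top.ne

lemma norm_single_zero (t : ℝ) : ‖(EuclideanSpace.single (0 : Fin d) t : RSpace d)‖ = |t| := by
  rw [PiLp.norm_single, Real.norm_eq_abs]

/-- The vector u and its counterpart v on the first axis have equal norm, so the reflection in the
hyperplane orthogonal to v - u maps v to u while preserving volume and the unit ball. -/
lemma volume_real_unit_inter (u : RSpace d) :
    volume.real (Metric.closedBall (0 : RSpace d) 1 ∩ Metric.closedBall u 1) =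
      unitBallVolume d * overlapCoeff d ‖u‖ := by
  have h : ‖(EuclideanSpace.single (0 : Fin d) ‖u‖ : RSpace d)‖ = ‖u‖ := by
    rw [norm_single_zero, abs_norm]
  set v : RSpace d := EuclideanSpace.single (0 : Fin d) ‖u‖ with hv
  let R : RSpace d ≃ₗᵢ[ℝ] RSpace d := (Submodule.span ℝ {v - u})ᗮ.reflection
  have hR : R v = u := Submodule.reflection_sub h
  have hpre : R ⁻¹' (Metric.closedBall (0 : RSpace d) 1 ∩ Metric.closedBall u 1) =
      Metric.closedBall (0 : RSpace d) 1 ∩ Metric.closedBall v 1 := by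
    ext z
    simp only [mem_preimage, mem_inter_iff, Metric.mem_closedBall, dist_zero_right,
      LinearIsometryEquiv.norm_map]
    rw [← hR, LinearIsometryEquiv.dist_map]
  rw [overlapCoeff, mul_div_cancel₀ _ (unitBallVolume_pos d).ne', ← hv, ← hpre, measureReal_def,
    measureReal_def, R.measurePreserving.measure_preimage
      (measurableSet_closedBall.inter measurableSet_closedBall).nullMeasurableSet]

lemma volume_real_inter (x y : RSpace d) {r : ℝ} (hr : 0 < r) :
    volume.real (Metric.closedBall x r ∩ Metric.closedBall y r) =
      unitBallVolume d * r ^ d * overlapCoeff d (‖x - y‖ / r) := by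
  have h1 : (x + ·) ⁻¹' (Metric.closedBall x r ∩ Metric.closedBall y r) =
      r • (Metric.closedBall (0 : RSpace d) 1 ∩ Metric.closedBall (r⁻¹ • (y - x)) 1) := by
    rw [smul_set_inter₀ hr.ne', smul_closedBall' hr.ne', smul_closedBall' hr.ne', preimage_inter,
      preimage_add_closedBall, preimage_add_closedBall, smul_zero, sub_self, smul_inv_smul₀ hr.ne',
      Real.norm_eq_abs, abs_of_pos hr, mul_one]
  have h2 : ‖r⁻¹ • (y - x)‖ = ‖x - y‖ / r := by
    rw [norm_smul, norm_inv, Real.norm_eq_abs, abs_of_pos hr, norm_sub_rev, inv_mul_eq_div]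
  rw [measureReal_def, ← measure_preimage_add volume x, h1,
    Measure.addHaar_smul_of_nonneg volume hr.le, ENNReal.toReal_mul,
    ENNReal.toReal_ofReal (by positivity), ← measureReal_def, volume_real_unit_inter, h2,
    finrank_euclideanSpace_fin]
  ring

/-- Dominated convergence: the indicator of the moving ball is locally constant in t at every z off
the unit sphere around the centre, and that sphere is null. -/
lemma continuous_overlapCoeff : Continuous (overlapCoeff d) := by
  classical
  refine Continuous.div_const ?_ _
  have hsingle : Continuous fun t : ℝ => (EuclideanSpace.single (0 : Fin d) t : RSpace d) := by
    have : Isometry fun t : ℝ => (EuclideanSpace.single (0 : Fin d) t : RSpace d) :=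
      Isometry.of_dist_eq fun s t => by
        rw [PiLp.dist_single_same]
    exact this.continuous
  rw [continuous_iff_continuousAt]
  intro t₀
  have hint : ∀ t : ℝ, volume.real (Metric.closedBall (0 : RSpace d) 1 ∩
      Metric.closedBall (EuclideanSpace.single (0 : Fin d) t) 1) =
      ∫ z in Metric.closedBall (0 : RSpace d) 1,
        (Metric.closedBall (EuclideanSpace.single (0 : Fin d) t) 1).indicator 1 z := fun t => by
    rw [integral_indicator_one measurableSet_closedBall,
      measureReal_restrict_apply measurableSet_closedBall, inter_comm]
  simp_rw [hint]
  refine continuousAt_of_dominated (bound := fun _ => 1) ?_ ?_ ?_ ?_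
  · exact Eventually.of_forall fun t =>
      (measurable_one.indicator measurableSet_closedBall).aestronglyMeasurable
  · refine Eventually.of_forall fun t => ae_of_all _ fun z => ?_
    rw [indicator_apply]
    split_ifs <;> simp
  · exact integrableOn_const measure_closedBall_lt_top.ne
  · refine ae_restrict_of_ae ?_
    have hsph : ∀ᵐ z : RSpace d,
        z ∉ Metric.sphere (EuclideanSpace.single (0 : Fin d) t₀ : RSpace d) 1 :=
      measure_eq_zero_iff_ae_notMem.1 (Measure.addHaar_sphere_of_ne_zero volume _ one_ne_zero)
    filter_upwards [hsph] with z hz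
    have hdist : Continuous fun t : ℝ => dist z (EuclideanSpace.single (0 : Fin d) t) := by
      fun_prop
    rcases lt_or_gt_of_ne (show dist z (EuclideanSpace.single (0 : Fin d) t₀) ≠ 1 from hz)
      with h | h
    · refine (continuousAt_const (y := (1 : ℝ))).congr ?_
      filter_upwards [hdist.continuousAt.eventually (gt_mem_nhds h)] with t ht
      rw [indicator_of_mem (Metric.mem_closedBall.2 ht.le)]; rfl
    · refine (continuousAt_const (y := (0 : ℝ))).congr ?_
      filter_upwards [hdist.continuousAt.eventually (lt_mem_nhds h)] with t ht
      rw [indicator_of_notMem fun h' => (Metric.mem_closedBall.1 h').not_gt ht]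

end overlap

/-! ### Laws of one and two ball counts -/

section poissonLaws

open scoped ENNReal NNReal

variable {d : ℕ} {Ω : Type*} [MeasurableSpace Ω] {P : Measure Ω}
  {lam : ℝ} {X : Ω → Set (RSpace d)} {W : Set (RSpace d)} {T : Ω → Finset (RSpace d)}

lemma lintegral_poissonMeasure_ofReal {f : ℕ → ℝ} (hf : ∀ n, f n ∈ Icc (0 : ℝ) 1) (a : ℝ) :
    ∫⁻ n, ENNReal.ofReal (f n) ∂(poissonMeasure a.toNNReal) = ENNReal.ofReal (poissonMean f a) := by
  refine (ofReal_integral_eq_lintegral_ofReal ?_ (ae_of_all _ fun n => (hf n).1)).symm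
  refine Integrable.of_bound (measurable_of_countable f).aestronglyMeasurable 1
    (ae_of_all _ fun n => ?_)
  rw [Real.norm_eq_abs, abs_of_nonneg (hf n).1]
  exact (hf n).2

lemma ballCount_eq_ncard {Y : Set (RSpace d)} {S : Finset (RSpace d)}
    (hS : (S : Set (RSpace d)) = Y ∩ W) {x : RSpace d} {r : ℝ}
    (hx : Metric.closedBall x r ⊆ W) :
    ballCount r x S = (Y ∩ Metric.closedBall x r).ncard := by
  classical
  rw [ballCount, ← Set.ncard_coe_finset]
  congr 1
  ext y
  have : y ∈ S ↔ y ∈ Y ∧ y ∈ W := by rw [← Finset.mem_coe, hS]; rfl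
  simp only [Finset.coe_filter, this, mem_inter_iff, Metric.mem_closedBall, mem_ofPred_eq]
  exact ⟨fun h => ⟨h.1.1, h.2⟩, fun h => ⟨⟨h.1, hx h.2⟩, h.2⟩⟩

lemma IsPoissonProcess.lintegral_ncard (hX : IsPoissonProcess P lam X)
    {A : Set (RSpace d)} (hA : MeasurableSet A) (hAb : Bornology.IsBounded A) (f : ℕ → ℝ≥0∞) :
    ∫⁻ ω, f (X ω ∩ A).ncard ∂P = ∫⁻ n, f n ∂(poissonMeasure (lam * volume.real A).toNNReal) := by
  rw [← hX.law_count A hA hAb,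
    lintegral_map (measurable_of_countable f) (hX.isPointProcess.measurable_ncard hA)]

lemma IsPoissonProcess.lintegral_three_ncard [IsProbabilityMeasure P]
    (hX : IsPoissonProcess P lam X) {D : Fin 3 → Set (RSpace d)}
    (hD : ∀ i, MeasurableSet (D i)) (hDb : ∀ i, Bornology.IsBounded (D i))
    (hDd : ∀ i j, i ≠ j → Disjoint (D i) (D j)) (f : ℕ → ℕ → ℕ → ℝ≥0∞) :
    ∫⁻ ω, f (X ω ∩ D 0).ncard (X ω ∩ D 1).ncard (X ω ∩ D 2).ncard ∂P =
      ∫⁻ i, ∫⁻ j, ∫⁻ k, f i j k ∂(poissonMeasure (lam * volume.real (D 2)).toNNReal)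
        ∂(poissonMeasure (lam * volume.real (D 1)).toNNReal)
        ∂(poissonMeasure (lam * volume.real (D 0)).toNNReal) := by
  have hm := fun i => hX.isPointProcess.measurable_ncard (hD i)
  have hind := hX.indep_count 3 D hD hDb hDd
  have h1 : IndepFun (fun ω => (X ω ∩ D 0).ncard)
      (fun ω => ((X ω ∩ D 1).ncard, (X ω ∩ D 2).ncard)) P :=
    (hind.indepFun_prodMk hm 1 2 0 (by decide) (by decide)).symm
  have h2 : IndepFun (fun ω => (X ω ∩ D 1).ncard) (fun ω => (X ω ∩ D 2).ncard) P :=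
    hind.indepFun (show (1 : Fin 3) ≠ 2 by decide)
  have hlaw : P.map (fun ω => ((X ω ∩ D 1).ncard, (X ω ∩ D 2).ncard)) =
      (poissonMeasure (lam * volume.real (D 1)).toNNReal).prod
        (poissonMeasure (lam * volume.real (D 2)).toNNReal) := by
    rw [(indepFun_iff_map_prod_eq_prod_map_map (hm 1).aemeasurable (hm 2).aemeasurable).1 h2,
      hX.law_count _ (hD 1) (hDb 1), hX.law_count _ (hD 2) (hDb 2)]
  have hmf : ∀ i, Measurable fun q : ℕ × ℕ => f i q.1 q.2 := fun i => measurable_of_countable _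
  have hmf' : Measurable (Function.uncurry fun (i : ℕ) (q : ℕ × ℕ) => f i q.1 q.2) :=
    measurable_of_countable _
  have h3 := IndepFun.lintegral_eq h1 (hm 0) ((hm 1).prodMk (hm 2))
    (f := fun (i : ℕ) (q : ℕ × ℕ) => f i q.1 q.2) hmf'
  rw [hlaw] at h3
  simp_rw [lintegral_prod _ (hmf _).aemeasurable] at h3
  rw [h3]
  exact hX.lintegral_ncard (hD 0) (hDb 0) fun i =>
    ∫⁻ j, ∫⁻ k, f i j k ∂(poissonMeasure (lam * volume.real (D 2)).toNNReal)
      ∂(poissonMeasure (lam * volume.real (D 1)).toNNReal)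

variable {p : ℕ → ℝ} {r m : ℝ}

lemma IsPoissonProcess.lintegral_ballCount (hX : IsPoissonProcess P lam X)
    (hT : ∀ ω, (T ω : Set (RSpace d)) = X ω ∩ W) (hp : ∀ n, p n ∈ Icc (0 : ℝ) 1) (hr : 0 ≤ r)
    (hm : m = lam * unitBallVolume d * r ^ d) {x : RSpace d} (hx : Metric.closedBall x r ⊆ W) :
    ∫⁻ ω, ENNReal.ofReal (p (ballCount r x (T ω))) ∂P = ENNReal.ofReal (poissonMean p m) := by
  simp_rw [fun ω => ballCount_eq_ncard (hT ω) hx]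
  rw [hX.lintegral_ncard measurableSet_closedBall Metric.isBounded_closedBall
    fun n => ENNReal.ofReal (p n), lintegral_poissonMeasure_ofReal hp, volume_real_closedBall x hr,
    hm, mul_assoc]

/-- The two balls are cut into the lens and two crescents, which are disjoint and so carry
independent Poisson counts; the ball counts share the lens count. -/
lemma IsPoissonProcess.lintegral_two_ballCounts [NeZero d] [IsProbabilityMeasure P]
    (hX : IsPoissonProcess P lam X)
    (hT : ∀ ω, (T ω : Set (RSpace d)) = X ω ∩ W) (hp : ∀ n, p n ∈ Icc (0 : ℝ) 1) (hr : 0 < r)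
    (hlam : 0 ≤ lam) (hm : m = lam * unitBallVolume d * r ^ d) {x y : RSpace d}
    (hx : Metric.closedBall x r ⊆ W)
    (hy : Metric.closedBall y r ⊆ W) (e : ℕ) :
    ∫⁻ ω, ENNReal.ofReal (p (e + ballCount r x (T ω))) *
        ENNReal.ofReal (p (e + ballCount r y (T ω))) ∂P =
      ENNReal.ofReal (pairRetention p m e (overlapCoeff d (‖x - y‖ / r))) := by
  set Bx := Metric.closedBall x r
  set By := Metric.closedBall y r
  have hBx : MeasurableSet Bx := measurableSet_closedBall
  have hBy : MeasurableSet By := measurableSet_closedBall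
  have hbx : Bornology.IsBounded Bx := Metric.isBounded_closedBall
  have hby : Bornology.IsBounded By := Metric.isBounded_closedBall
  have hsplit : ∀ (ω : Ω) (C D : Set (RSpace d)), Bornology.IsBounded C →
      (X ω ∩ C).ncard = (X ω ∩ (C ∩ D)).ncard + (X ω ∩ (C \ D)).ncard := fun ω C D hC => by
    have := ncard_inter_add_ncard_sdiff_eq_ncard (X ω ∩ C) D
      (hX.isPointProcess.locallyFinite ω C hC)
    rw [← this, inter_assoc, inter_sdiff_assoc]
  have hω : ∀ ω, ENNReal.ofReal (p (e + ballCount r x (T ω))) *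
      ENNReal.ofReal (p (e + ballCount r y (T ω))) =
      ENNReal.ofReal (p (e + (X ω ∩ (Bx ∩ By)).ncard + (X ω ∩ (Bx \ By)).ncard)) *
        ENNReal.ofReal (p (e + (X ω ∩ (Bx ∩ By)).ncard + (X ω ∩ (By \ Bx)).ncard)) := fun ω => by
    rw [ballCount_eq_ncard (hT ω) hx, ballCount_eq_ncard (hT ω) hy, hsplit ω Bx By hbx,
      hsplit ω By Bx hby, inter_comm By Bx, add_assoc, add_assoc]
  simp_rw [hω]
  have hBd : Disjoint Bx (By \ Bx) := disjoint_sdiff_right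
  have hBd' : Disjoint By (Bx \ By) := disjoint_sdiff_right
  have hd1 : Disjoint (Bx ∩ By) (Bx \ By) := hBd'.mono_left inter_subset_right
  have hd2 : Disjoint (Bx ∩ By) (By \ Bx) := hBd.mono_left inter_subset_left
  have hd3 : Disjoint (Bx \ By) (By \ Bx) := hBd.mono_left sdiff_subset
  have h3 := hX.lintegral_three_ncard (D := ![Bx ∩ By, Bx \ By, By \ Bx])
    (by
      simp only [Fin.forall_fin_succ, Matrix.cons_val_zero, Matrix.cons_val_succ]
      exact ⟨MeasurableSet.inter hBx hBy, MeasurableSet.diff hBx hBy, MeasurableSet.diff hBy hBx,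
        fun i => i.elim0⟩)
    (by
      simp only [Fin.forall_fin_succ, Matrix.cons_val_zero, Matrix.cons_val_succ]
      exact ⟨hbx.subset inter_subset_left, hbx.subset sdiff_subset, hby.subset sdiff_subset,
        fun i => i.elim0⟩)
    (by simp [Fin.forall_fin_succ, hd1, hd2, hd3, hd1.symm, hd2.symm, hd3.symm])
    fun i j k => ENNReal.ofReal (p (e + i + j)) * ENNReal.ofReal (p (e + i + k))
  simp only [Matrix.cons_val_zero, Matrix.cons_val_one, Matrix.cons_val] at h3
  rw [h3]
  have hv1 : lam * volume.real (Bx ∩ By) = m * overlapCoeff d (‖x - y‖ / r) := by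
    rw [volume_real_inter x y hr, hm]; ring
  have hv2 : lam * volume.real (Bx \ By) = m * (1 - overlapCoeff d (‖x - y‖ / r)) := by
    have := measureReal_inter_add_sdiff (μ := volume) (s := Bx) hBy measure_closedBall_lt_top.ne
    rw [volume_real_closedBall x hr.le, volume_real_inter x y hr] at this
    rw [eq_sub_of_add_eq' this, hm]; ring
  have hv3 : lam * volume.real (By \ Bx) = m * (1 - overlapCoeff d (‖x - y‖ / r)) := by
    have := measureReal_inter_add_sdiff (μ := volume) (s := By) hBx measure_closedBall_lt_top.ne
    rw [volume_real_closedBall y hr.le, volume_real_inter y x hr, norm_sub_rev] at this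
    rw [eq_sub_of_add_eq' this, hm]; ring
  rw [hv1, hv2, hv3]
  set w := overlapCoeff d (‖x - y‖ / r)
  simp_rw [lintegral_const_mul _ (measurable_of_countable _),
    lintegral_mul_const _ (measurable_of_countable _),
    fun i => lintegral_poissonMeasure_ofReal (fun j => hp (e + i + j)) (m * (1 - w))]
  have hm0 : 0 ≤ m * (1 - w) := hv2 ▸ mul_nonneg hlam measureReal_nonneg
  have hG : ∀ i, poissonMean (fun j => p (e + i + j)) (m * (1 - w)) ∈ Icc (0 : ℝ) 1 := fun i =>
    poissonMean_mem_Icc hm0 fun _ => hp _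
  -- Given the lens count i, the crescent counts are independent with equal means, so the product of
  -- the two inner means is a square.
  simp_rw [← sq, fun i => (ENNReal.ofReal_pow (hG i).1 2).symm]
  exact lintegral_poissonMeasure_ofReal (fun i => sq_mem_Icc (hG i)) _

end poissonLaws

/-! ### Densities and pair correlation of the thinned process -/

section thinnedDensities

open scoped ENNReal NNReal

variable {d : ℕ} {Ω : Type*} [MeasurableSpace Ω] {P : Measure Ω} [IsProbabilityMeasure P]
  {lam r m : ℝ} {p : ℕ → ℝ}
  {X : Ω → Set (RSpace d)} {κ : Ω → ℕ∞} {ξ : ℕ → Ω → RSpace d} {U : ℕ → Ω → ℝ}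

/-- Retention of a point of A depends on points up to distance r outside A, so the window is an
r-enlargement of a ball around A. -/
lemma exists_window {A : Set (RSpace d)} (hA : Bornology.IsBounded A) (hr : 0 ≤ r) :
    ∃ W : Set (RSpace d), MeasurableSet W ∧ Bornology.IsBounded W ∧ A ⊆ W ∧
      ∀ x ∈ A, Metric.closedBall x r ⊆ W := by
  obtain ⟨R, hR⟩ := hA.subset_closedBall 0
  have h : ∀ x ∈ A, Metric.closedBall x r ⊆ Metric.closedBall 0 (R + r) := fun x hx => by
    refine Metric.closedBall_subset_closedBall' ?_
    linarith [Metric.mem_closedBall.1 (hR hx)]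
  exact ⟨_, measurableSet_closedBall, Metric.isBounded_closedBall,
    fun x hx => h x hx (Metric.mem_closedBall_self hr), h⟩

lemma IsPointProcess.exists_finset (hX : IsPointProcess X)
    {W : Set (RSpace d)} (hW : Bornology.IsBounded W) :
    ∃ T : Ω → Finset (RSpace d), ∀ ω, (T ω : Set (RSpace d)) = X ω ∩ W :=
  ⟨fun ω => (hX.locallyFinite ω W hW).toFinset, fun _ => Set.Finite.coe_toFinset _⟩

lemma poissonMean_nonneg (hp : ∀ n, p n ∈ Icc (0 : ℝ) 1) (a : ℝ) : 0 ≤ poissonMean p a :=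
  integral_nonneg fun n => (hp n).1

theorem IsPoissonProcess.hasIntensityDensity_thinning (hX : IsPoissonProcess P lam X)
    (hM : IsIndependentMarking P X κ ξ U) (hp : ∀ n, p n ∈ Icc (0 : ℝ) 1) (hlam : 0 ≤ lam)
    (hr : 0 ≤ r) (hm : m = lam * unitBallVolume d * r ^ d) :
    HasIntensityDensity P (thinning p r X κ ξ U) fun _ => lam * poissonMean p m where
  measurable := measurable_const
  nonneg _ := mul_nonneg hlam (poissonMean_nonneg hp m)
  expected_count B hB hBb := by
    classical
    obtain ⟨W, hW, hWb, hBW, hBr⟩ := exists_window hBb hr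
    obtain ⟨T, hT⟩ := hX.isPointProcess.exists_finset hWb
    rw [hM.lintegral_encard_thinning hp hT hB hBW hBr,
      hX.lintegral_sum_ballCount hlam hW hWb hT hB r (φ := fun n => ENNReal.ofReal (p n))
      fun n => ENNReal.ofReal_le_one.2 (hp n).2]
    have h : ∀ x, ∫⁻ ω, (if x ∈ B then ENNReal.ofReal (p (ballCount r x (T ω))) else 0) ∂P =
        B.indicator (fun _ => ENNReal.ofReal (poissonMean p m)) x := fun x => by
      by_cases hx : x ∈ B
      · simp only [if_pos hx, indicator_of_mem hx]
        exact hX.lintegral_ballCount hT hp hr hm (hBr x hx)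
      · simp only [if_neg hx, indicator_of_notMem hx, lintegral_zero]
    simp_rw [h]
    rw [setLIntegral_indicator hB, inter_eq_left.2 hBW, setLIntegral_const, setLIntegral_const,
      ← mul_assoc, ENNReal.ofReal_mul hlam]

/-- The probability that two points at distance `τ` are both retained. -/
noncomputable def distancePairRetention [NeZero d] (p : ℕ → ℝ) (m r τ : ℝ) : ℝ :=
  pairRetention p m (if τ ≤ r then 1 else 0) (overlapCoeff d (τ / r))

variable [NeZero d]

lemma distancePairRetention_nonneg (p : ℕ → ℝ) (m r τ : ℝ) :
    0 ≤ distancePairRetention (d := d) p m r τ :=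
  integral_nonneg fun _ => sq_nonneg _

lemma continuous_pairRetention_overlapCoeff (hp : ∀ n, p n ∈ Icc (0 : ℝ) 1) (hm : 0 ≤ m) (e : ℕ)
    (r : ℝ) : Continuous fun τ : ℝ => pairRetention p m e (overlapCoeff d (τ / r)) :=
  (continuousOn_pairRetention hp e hm).comp_continuous
    (continuous_overlapCoeff.comp (continuous_id.div_const r)) fun _ => overlapCoeff_mem_Icc _

lemma measurable_distancePairRetention (hp : ∀ n, p n ∈ Icc (0 : ℝ) 1) (hm : 0 ≤ m) (r : ℝ) :
    Measurable (distancePairRetention (d := d) p m r) := by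
  have h : distancePairRetention (d := d) p m r = fun τ => if τ ≤ r then
      pairRetention p m 1 (overlapCoeff d (τ / r)) else
      pairRetention p m 0 (overlapCoeff d (τ / r)) := by
    funext τ
    unfold distancePairRetention
    split_ifs <;> rfl
  rw [h]
  exact Measurable.ite measurableSet_Iic
    (continuous_pairRetention_overlapCoeff hp hm 1 r).measurable
    (continuous_pairRetention_overlapCoeff hp hm 0 r).measurable

lemma continuousOn_distancePairRetention_Ioc (hp : ∀ n, p n ∈ Icc (0 : ℝ) 1) (hm : 0 ≤ m) :
    ContinuousOn (distancePairRetention (d := d) p m r) (Ioc 0 r) :=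
  (continuous_pairRetention_overlapCoeff (d := d) hp hm 1 r).continuousOn.congr fun τ hτ => by
    rw [distancePairRetention, if_pos hτ.2]

lemma continuousOn_distancePairRetention_Ioi (hp : ∀ n, p n ∈ Icc (0 : ℝ) 1) (hm : 0 ≤ m) :
    ContinuousOn (distancePairRetention (d := d) p m r) (Ioi r) :=
  (continuous_pairRetention_overlapCoeff (d := d) hp hm 0 r).continuousOn.congr fun τ hτ => by
    rw [distancePairRetention, if_neg (not_le.2 hτ)]

theorem IsPoissonProcess.hasPairDensity_thinning (hX : IsPoissonProcess P lam X)
    (hM : IsIndependentMarking P X κ ξ U) (hp : ∀ n, p n ∈ Icc (0 : ℝ) 1) (hlam : 0 ≤ lam)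
    (hr : 0 < r) (hm : m = lam * unitBallVolume d * r ^ d) :
    HasPairDensity P (thinning p r X κ ξ U)
      fun x y => lam ^ 2 * distancePairRetention (d := d) p m r ‖x - y‖ where
  measurable := by
    have hm0 : 0 ≤ m := by
      rw [hm]; have := (unitBallVolume_pos d).le; positivity
    have h : Measurable fun q : RSpace d × RSpace d => ‖q.1 - q.2‖ := by fun_prop
    exact ((measurable_distancePairRetention hp hm0 r).comp h).const_mul _
  nonneg x y := mul_nonneg (sq_nonneg _) (distancePairRetention_nonneg p m r _)
  expected_count A B hA hAb hB hBb := by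
    classical
    obtain ⟨W, hW, hWb, hABW, hABr⟩ := exists_window (hAb.union hBb) hr.le
    obtain ⟨T, hT⟩ := hX.isPointProcess.exists_finset hWb
    have hAW := subset_union_left.trans hABW
    have hBW := subset_union_right.trans hABW
    have hAr := fun x hx => hABr x (Or.inl hx)
    have hBr := fun x hx => hABr x (Or.inr hx)
    rw [hM.lintegral_encard_thinning_pairs hp hT hA hAW hAr hB hBW hBr,
      hX.lintegral_sum_sum_ballCount hlam hW hWb hT hA hB r
      (Φ := fun i j => ENNReal.ofReal (p i) * ENNReal.ofReal (p j))
      fun i j => mul_le_one' (ENNReal.ofReal_le_one.2 (hp i).2) (ENNReal.ofReal_le_one.2 (hp j).2)]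
    have h : ∀ x y, ∫⁻ ω, (if x ∈ A ∧ y ∈ B then
        ENNReal.ofReal (p ((if dist y x ≤ r then 1 else 0) + ballCount r x (T ω))) *
          ENNReal.ofReal (p ((if dist y x ≤ r then 1 else 0) + ballCount r y (T ω))) else 0) ∂P =
        A.indicator (fun x => B.indicator (fun y =>
          ENNReal.ofReal (distancePairRetention (d := d) p m r ‖x - y‖)) y) x := fun x y => by
      by_cases hx : x ∈ A
      · by_cases hy : y ∈ B
        · simp only [if_pos (And.intro hx hy), indicator_of_mem hx, indicator_of_mem hy]
          rw [hX.lintegral_two_ballCounts hT hp hr hlam hm (hAr x hx) (hBr y hy),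
            distancePairRetention, dist_comm, dist_eq_norm]
        · simp only [hy, and_false, if_false, lintegral_zero, indicator_of_mem hx,
            indicator_of_notMem hy]
      · simp only [hx, false_and, if_false, lintegral_zero, indicator_of_notMem hx]
    have hin : ∀ x, ENNReal.ofReal lam * ∫⁻ y in W, A.indicator (fun x => B.indicator (fun y =>
          ENNReal.ofReal (distancePairRetention (d := d) p m r ‖x - y‖)) y) x =
        A.indicator (fun x => ENNReal.ofReal lam * ∫⁻ y in B,
          ENNReal.ofReal (distancePairRetention (d := d) p m r ‖x - y‖)) x := fun x => by
      by_cases hx : x ∈ A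
      · simp only [indicator_of_mem hx]
        rw [setLIntegral_indicator hB, inter_eq_left.2 hBW]
      · simp only [indicator_of_notMem hx, lintegral_zero, mul_zero]
    simp_rw [h, hin]
    rw [setLIntegral_indicator hA, inter_eq_left.2 hAW, ← lintegral_const_mul' _ _
      ENNReal.ofReal_ne_top]
    refine lintegral_congr fun x => ?_
    rw [← lintegral_const_mul' _ _ ENNReal.ofReal_ne_top,
      ← lintegral_const_mul' _ _ ENNReal.ofReal_ne_top]
    refine lintegral_congr fun y => ?_
    rw [ENNReal.ofReal_mul (sq_nonneg lam), sq, ENNReal.ofReal_mul hlam, mul_assoc]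

theorem IsPoissonProcess.isRadialPairCorrelation_thinning (hX : IsPoissonProcess P lam X)
    (hM : IsIndependentMarking P X κ ξ U) (hp : ∀ n, p n ∈ Icc (0 : ℝ) 1) (hlam : 0 < lam)
    (hr : 0 < r) (hm : m = lam * unitBallVolume d * r ^ d) (hpos : 0 < poissonMean p m) :
    IsRadialPairCorrelation P (thinning p r X κ ξ U)
      fun τ => distancePairRetention (d := d) p m r τ / poissonMean p m ^ 2 := by
  refine ⟨_, _, hX.hasIntensityDensity_thinning hM hp hlam.le hr.le hm,
    fun _ => mul_pos hlam hpos, hX.hasPairDensity_thinning hM hp hlam.le hr hm, fun x y _ => ?_⟩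
  field_simp

end thinnedDensities

/-! ### Assembly of the expansions -/

theorem mainTheorem9 (d : ℕ) [NeZero d] (p : ℕ → ℝ) (hp : ∀ n, p n ∈ Set.Icc (0 : ℝ) 1)
    (hp0 : p 0 = 0) (hp1 : 0 < p 1) :
    ∃ C μ₀ : ℝ, 0 < μ₀ ∧
      ∀ lam r μ : ℝ, 0 < lam → 0 < r → μ = lam * unitBallVolume d * r ^ d → μ ≤ μ₀ →
      ∀ {Ω : Type*} [MeasurableSpace Ω] (P : Measure Ω) [IsProbabilityMeasure P]
        (X : Ω → Set (RSpace d)) (κ : Ω → ℕ∞) (ξ : ℕ → Ω → RSpace d) (U : ℕ → Ω → ℝ),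
        IsPoissonProcess P lam X → IsIndependentMarking P X κ ξ U →
        -- intensity of the thinned process
        (∃ ρ : ℝ, HasIntensityDensity P (thinning p r X κ ξ U) (fun _ => ρ) ∧
          ρ = lam * ∫ n, p n ∂(poissonMeasure μ.toNNReal) ∧
          |ρ - lam * (μ * p 1 + μ ^ 2 * (p 2 / 2 - p 1))| ≤ lam * (C * μ ^ 3)) ∧
        -- radial pair correlation, in its version that is continuous on `(0, r]` and `(r, ∞)`
        (∃ g : ℝ → ℝ, IsRadialPairCorrelation P (thinning p r X κ ξ U) g ∧
          ContinuousOn g (Set.Ioc 0 r) ∧ ContinuousOn g (Set.Ioi r) ∧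
          (∀ t : ℝ, 1 < t → t ≤ 2 → |g (t * r) - overlapCoeff d t / μ| ≤ C) ∧
          (∀ t : ℝ, 0 < t → t ≤ 1 →
            |g (t * r) - 1 / μ ^ 2 *
              (1 + μ * (p 2 / p 1 + overlapCoeff d t * (1 - p 2 / p 1) ^ 2))| ≤ C)) := by
  have hc1 : p 1 ≤ 1 := (hp 1).2
  -- The three entries serve the intensity, the range t > 1 and the range t ≤ 1. The threshold p 1 /
  -- 8 chosen below is the one that keeps the normalised mean above p 1 / 2.
  set C : ℝ := max 3 (max (128 / p 1 ^ 2) ((33 + 15 * (2 / p 1 ^ 2)) * 4 / p 1 ^ 2)) with hC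
  have hC3 : 3 ≤ C := le_max_left _ _
  have hCfar : 128 / p 1 ^ 2 ≤ C := (le_max_left _ _).trans (le_max_right _ _)
  have hCnear : (33 + 15 * (2 / p 1 ^ 2)) * 4 / p 1 ^ 2 ≤ C :=
    (le_max_right _ _).trans (le_max_right _ _)
  refine ⟨C, p 1 / 8, by positivity, ?_⟩
  intro lam r μ hlam hr hμ hμ₀ Ω _ P _ X κ ξ U hX hM
  have hμpos : 0 < μ := by
    rw [hμ]; have := unitBallVolume_pos d; positivity
  have hμ1 : μ ≤ 1 := by linarith
  have hmean := abs_poissonMean_sub_three_terms_le hμpos.le hμ1 hp hp0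
  have hn : |poissonMean p μ / μ - (p 1 + μ * (p 2 / 2 - p 1))| ≤ 3 * μ ^ 2 := by
    have e : poissonMean p μ / μ - (p 1 + μ * (p 2 / 2 - p 1)) =
        (poissonMean p μ - (μ * p 1 + μ ^ 2 * (p 2 / 2 - p 1))) / μ := by
      field_simp
    rw [e, abs_div, abs_of_pos hμpos, div_le_iff₀ hμpos]
    linarith
  have hpos : 0 < poissonMean p μ := by
    have h := (abs_normalizedMean_bounds hμpos hc1 hμ₀ (hp 2) hn).2.1
    have : 0 < poissonMean p μ / μ := by linarith
    exact (div_pos_iff_of_pos_right hμpos).1 this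
  have hmul : μ * (poissonMean p μ / μ) = poissonMean p μ := mul_div_cancel₀ _ hμpos.ne'
  refine ⟨⟨lam * poissonMean p μ, hX.hasIntensityDensity_thinning hM hp hlam.le hr.le hμ, rfl, ?_⟩,
    fun τ => distancePairRetention (d := d) p μ r τ / poissonMean p μ ^ 2,
    hX.isRadialPairCorrelation_thinning hM hp hlam hr hμ hpos,
    (continuousOn_distancePairRetention_Ioc hp hμpos.le).div_const _,
    (continuousOn_distancePairRetention_Ioi hp hμpos.le).div_const _, fun t ht1 ht2 => ?_,
    fun t ht0 ht1 => ?_⟩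
  · rw [← mul_sub, abs_mul, abs_of_pos hlam]
    gcongr
    exact hmean.trans (by gcongr)
  · have hle : ¬ t * r ≤ r := by
      rw [not_le]; exact lt_mul_of_one_lt_left hr ht1
    -- With e = 0 and p 0 = 0 only the term of a single point in the lens survives.
    have hH := abs_pairRetention_sub_le hp 0 hμpos.le hμ1 (overlapCoeff_mem_Icc (d := d) t)
    simp only [hp0, zero_add, ne_eq, OfNat.ofNat_ne_zero, not_false_eq_true, zero_pow, zero_mul,
      mul_zero] at hH
    have h := abs_div_sub_le_far hμpos hp1 hc1 hμ₀ (hp 2) hn (overlapCoeff_mem_Icc (d := d) t) hH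
    rw [hmul] at h
    simp only [distancePairRetention, if_neg hle, mul_div_cancel_right₀ t hr.ne']
    exact h.trans hCfar
  · have hle : t * r ≤ r := mul_le_of_le_one_left hr.le ht1
    -- For t ≤ 1, including t = 1 as the ball is closed, the two points are neighbours of each
    -- other, so e = 1.
    have hH := abs_pairRetention_sub_le hp 1 hμpos.le hμ1 (overlapCoeff_mem_Icc (d := d) t)
    have h := abs_div_sub_le_near hμpos hp1 hc1 hμ₀ (hp 2) hn (overlapCoeff_mem_Icc (d := d) t) hH
    rw [hmul] at h
    simp only [distancePairRetention, if_pos hle, mul_div_cancel_right₀ t hr.ne']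
    exact h.trans hCnear
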